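/- Let $M$ be a closed oriented smooth manifold of dimension $d$ and let $\mathbf k$ be a ring; homology is singular homology with coefficients in $\mathbf k$. Let $LM$ be the free loop space of $M$ (loops $[0,1]\to M$ of Sobolev class $H^1$, with the $H^1$ topology), let $L_{1/2}M=\{\eta\in LM : \eta(1/2)=\eta(0)\}$ with inclusion $\tilde j:L_{1/2}M\to LM$, let $LM\times_M LM=\{(\alpha,\beta) : \alpha(0)=\beta(0)\}$ with inclusion $\tilde\Delta: LM\times_M LM\to LM\times LM$, and let $\gamma:LM\times_M LM\to L_{1/2}M$, $\gamma(\alpha,\beta)=\alpha*\beta$, be the homeomorphism given by composition of loops ($\alpha*\beta(t)=\alpha(2t)$ for $t\le 1/2$, and $\beta(2t-1)$ for $t\ge 1/2$). For a codimension $d$ embedding $e:X\to Y$ with closed image, with a tubular neighbourhood $\exp:\nu\to Y$, $\pi:\nu\to X$, and Thom class $\tau\in H^d(Y,Y\setminus e(X);\mathbb Z)$, the umkehr map $e_!:H_{d+n}(Y)\to H_n(X)$ is the composite $$H_{d+n}(Y)\to H_{d+n}(Y,Y\setminus e(X))\xleftarrow{\ \cong\ }H_{d+n}(\nu,\nu\setminus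 0)\xrightarrow{\ \tau\cap\ }H_n(\nu)\xrightarrow{\ \pi_*\ }H_n(X),$$ where the isomorphism is induced by $\exp$ (excision) and $\tau$ is restricted to $\nu$ along $\exp$. The Thom class used for embeddings in $LM$ with image $L_{1/2}M$ is the pull-back along $ev(0)\times ev(1/2):LM\to M\times M$ of the Thom class of the diagonal of $M$ in $H^d(M\times M,M\times M\setminus\Delta;\mathbb Z)$ determined by the orientation. Let $\delta_{in}:LM\times_M LM\to LM$, $(\alpha,\beta)\mapsto\alpha*\beta$, and $\delta_{out}=\tilde\Delta$; the Cohen–Godin loop coproduct is $\Phi=(\delta_{out})_*\circ(\delta_{in})_!:H_{d+n}(LM)\to H_n(LM\times LM)$. Put $comp_!=\gamma_*^{-1}\circ\tilde j_!:H_{d+n}(LM)\to H_n(LM\times_M LM)$. Theorem. For every choice of tubular neighbourhoods of $\delta_{in}$ and of $\tilde j$, the excision maps above are isomorphisms (so that $(\delta_{in})_!$ and $\tilde j_!$ are defined), and for every $n\ge 0$: $comp_!$ is the umkehr map of the composition of loops, $(\delta_{in})_!=comp_!$, and $$\Phi=\tilde\Delta_*\circ comp_!.$$ -/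

import Mathlib

open CategoryTheory Limits AlgebraicTopology MeasureTheory
open scoped Manifold ContDiff unitInterval Simplicial

universe w v u

noncomputable section

namespace StringTopology


/-! ### Cap products on simplicial sets -/

section Cap

/-- The inclusion of the front `d`-face `[0, …, d]` of the `m`-simplex. -/
def frontFace {d n m : ℕ} (h : d + n = m) : (⦋d⦌ : SimplexCategory) ⟶ ⦋m⦌ :=
  SimplexCategory.mkHom ⟨fun i => ⟨i, by omega⟩, fun _ _ hij => hij⟩

/-- The inclusion of the back `n`-face `[d, …, m]` of the `m`-simplex, `m = d + n`. -/
def backFace {d n m : ℕ} (h : d + n = m) : (⦋n⦌ : SimplexCategory) ⟶ ⦋m⦌ :=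
  SimplexCategory.mkHom ⟨fun j => ⟨d + j, by omega⟩, fun _ _ hij => Nat.add_le_add_left hij d⟩

lemma frontFace_val {d n m : ℕ} (h : d + n = m) (i : Fin (d + 1)) :
    ((frontFace h).toOrderHom i : ℕ) = i := rfl

lemma backFace_val {d n m : ℕ} (h : d + n = m) (j : Fin (n + 1)) :
    ((backFace h).toOrderHom j : ℕ) = d + j := rfl

lemma δ_val {m : ℕ} (k : Fin (m + 2)) (j : Fin (m + 1)) :
    ((SimplexCategory.δ k).toOrderHom j : ℕ) = if (j : ℕ) < k then (j : ℕ) else j + 1 := by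
  change ((k.succAbove j : Fin (m + 2)) : ℕ) = _
  simp only [Fin.succAbove, Fin.lt_def, Fin.val_castSucc]
  split_ifs <;> rfl

lemma hom_ext_val {a b : ℕ} {f g : (⦋a⦌ : SimplexCategory) ⟶ ⦋b⦌}
    (h : ∀ j : Fin (a + 1), (f.toOrderHom j : ℕ) = g.toOrderHom j) : f = g := by
  ext j
  exact h j

lemma frontFace_δ_low {d n m : ℕ} (h : d + n = m) (h' : (d + 1) + n = m + 1)
    (i : Fin (d + 2)) (k : Fin (m + 2)) (hk : (k : ℕ) = i) :
    frontFace h ≫ SimplexCategory.δ k = SimplexCategory.δ i ≫ frontFace h' := by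
  refine hom_ext_val fun j => ?_
  change ((SimplexCategory.δ k).toOrderHom ((frontFace h).toOrderHom j) : ℕ) =
    ((frontFace h').toOrderHom ((SimplexCategory.δ i).toOrderHom j) : ℕ)
  refine (δ_val _ _).trans ?_
  rw [frontFace_val, hk]
  exact (δ_val i j).symm

lemma backFace_δ_low {d n m : ℕ} (h : d + n = m) (h' : (d + 1) + n = m + 1)
    (k : Fin (m + 2)) (hk : (k : ℕ) ≤ d) :
    backFace h ≫ SimplexCategory.δ k = backFace h' := by
  refine hom_ext_val fun j => ?_
  change ((SimplexCategory.δ k).toOrderHom ((backFace h).toOrderHom j) : ℕ) = _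
  erw [δ_val, backFace_val, backFace_val]
  split_ifs <;> omega

lemma frontFace_δ_high {d n m : ℕ} (h : d + n = m) (h' : d + (n + 1) = m + 1)
    (k : Fin (m + 2)) (hk : d + 1 ≤ (k : ℕ)) :
    frontFace h ≫ SimplexCategory.δ k = frontFace h' := by
  refine hom_ext_val fun j => ?_
  change ((SimplexCategory.δ k).toOrderHom ((frontFace h).toOrderHom j) : ℕ) = _
  refine (δ_val _ _).trans ?_
  rw [frontFace_val, if_pos (by omega)]
  exact (frontFace_val h' j).symm

lemma backFace_δ_high {d n m : ℕ} (h : d + n = m) (h' : d + (n + 1) = m + 1)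
    (i : Fin (n + 2)) (k : Fin (m + 2)) (hk : (k : ℕ) = d + i) :
    backFace h ≫ SimplexCategory.δ k = SimplexCategory.δ i ≫ backFace h' := by
  refine hom_ext_val fun j => ?_
  change ((SimplexCategory.δ k).toOrderHom ((backFace h).toOrderHom j) : ℕ) =
    ((backFace h').toOrderHom ((SimplexCategory.δ i).toOrderHom j) : ℕ)
  erw [δ_val, backFace_val, backFace_val, δ_val, hk]
  split_ifs <;> omega

lemma δ_zero_backFace {d n m : ℕ} (h : d + (n + 1) = m) (h' : (d + 1) + n = m) :
    SimplexCategory.δ 0 ≫ backFace h = backFace h' := by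
  refine hom_ext_val fun j => ?_
  change ((backFace h).toOrderHom ((SimplexCategory.δ 0).toOrderHom j) : ℕ) = _
  erw [backFace_val, backFace_val, δ_val]
  simp
  omega

lemma δ_last_frontFace {d n m : ℕ} (h : (d + 1) + n = m) (h' : d + (n + 1) = m) :
    SimplexCategory.δ (Fin.last _) ≫ frontFace h = frontFace h' := by
  refine hom_ext_val fun j => ?_
  change ((frontFace h).toOrderHom ((SimplexCategory.δ (Fin.last _)).toOrderHom j) : ℕ) = _
  refine (frontFace_val h _).trans ((δ_val _ _).trans ?_)
  rw [if_pos (by simpa using j.2)]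
  exact (frontFace_val h' j).symm

/-- The coboundary of integral cochains, `(δc)(s) = ∑ (-1)^i c(∂_i s)`. -/
def coboundary (X : SSet.{w}) (d : ℕ) : (X _⦋d⦌ → ℤ) →+ (X _⦋d + 1⦌ → ℤ) where
  toFun c := fun s => ∑ i : Fin (d + 2), (-1) ^ (i : ℕ) * c (X.δ i s)
  map_zero' := by ext; simp
  map_add' a b := by ext; simp [mul_add, Finset.sum_add_distrib]

variable {C : Type u} [Category.{v} C] [Abelian C] [HasCoproducts.{w} C] (R : C)

/-- The cap product with a `d`-cochain `c` on chains: `s ↦ c(front d-face of s) • (back face of s)`. -/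
def capChain (X : SSet.{w}) {d n m : ℕ} (h : d + n = m) (c : X _⦋d⦌ → ℤ) :
    (X.chainComplex R).X m ⟶ (X.chainComplex R).X n :=
  Sigma.desc fun s : X _⦋m⦌ =>
    c (X.map (frontFace h).op s) • X.ιChainComplex (X.map (backFace h).op s)

@[simp]
lemma ι_capChain (X : SSet.{w}) {d n m : ℕ} (h : d + n = m) (c : X _⦋d⦌ → ℤ) (s : X _⦋m⦌) :
    X.ιChainComplex s ≫ capChain R X h c =
      c (X.map (frontFace h).op s) • X.ιChainComplex (R := R) (X.map (backFace h).op s) :=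
  Sigma.ι_desc _ _

@[simp]
lemma ι_capChain_assoc (X : SSet.{w}) {d n m : ℕ} (h : d + n = m) (c : X _⦋d⦌ → ℤ) (s : X _⦋m⦌)
    {T : C} (g : (X.chainComplex R).X n ⟶ T) :
    X.ιChainComplex s ≫ capChain R X h c ≫ g =
      (c (X.map (frontFace h).op s) • X.ιChainComplex (R := R) (X.map (backFace h).op s)) ≫ g := by
  rw [← Category.assoc, ι_capChain]

lemma map_op_δ (X : SSet.{w}) {a m : ℕ} (f : (⦋a⦌ : SimplexCategory) ⟶ ⦋m⦌) (i : Fin (m + 2))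
    (s : X _⦋m + 1⦌) :
    X.map f.op (X.δ i s) = X.map (f ≫ SimplexCategory.δ i).op s := by
  simp [SimplicialObject.δ]

lemma δ_map_op (X : SSet.{w}) {a m : ℕ} (f : (⦋a + 1⦌ : SimplexCategory) ⟶ ⦋m⦌) (i : Fin (a + 2))
    (s : X _⦋m⦌) :
    X.δ i (X.map f.op s) = X.map (SimplexCategory.δ i ≫ f).op s := by
  simp [SimplicialObject.δ]

/-- The Leibniz rule for the cap product. -/
lemma d_capChain (X : SSet.{w}) {d n m : ℕ} (h : d + n = m) (c : X _⦋d⦌ → ℤ) :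
    (X.chainComplex R).d (m + 1) m ≫ capChain R X h c =
      (-1 : ℤ) ^ d • (capChain R X (show d + (n + 1) = m + 1 by omega) c ≫
        (X.chainComplex R).d (n + 1) n) +
      capChain R X (show (d + 1) + n = m + 1 by omega) (coboundary X d c) := by
  ext s
  have h1 : d + (n + 1) = m + 1 := by omega
  have h2 : (d + 1) + n = m + 1 := by omega
  have h3 : (d + 1) + (n + 1) = m + 2 := by omega
  simp only [SSet.ιChainComplex_d_assoc, Preadditive.sum_comp, Preadditive.zsmul_comp, ι_capChain,
    Preadditive.comp_add, Preadditive.comp_zsmul, ι_capChain_assoc, SSet.ιChainComplex_d,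
    map_op_δ, δ_map_op]
  rw [← Equiv.sum_comp (finCongr h3), Fin.sum_univ_add, Fin.sum_univ_succ (n := n + 1)]
  simp only [coboundary, AddMonoidHom.coe_mk, ZeroHom.coe_mk, δ_map_op]
  rw [Fin.sum_univ_castSucc (n := d + 1), δ_last_frontFace h2 h1, δ_zero_backFace h1 h2]
  have e1 : ∀ i : Fin (d + 1), frontFace h ≫ SimplexCategory.δ (finCongr h3 (Fin.castAdd (n + 1) i))
      = SimplexCategory.δ i.castSucc ≫ frontFace h2 :=
    fun i => frontFace_δ_low h h2 _ _ (by simp)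
  have e2 : ∀ i : Fin (d + 1), backFace h ≫ SimplexCategory.δ (finCongr h3 (Fin.castAdd (n + 1) i))
      = backFace h2 :=
    fun i => backFace_δ_low h h2 _ (by simp; omega)
  have e3 : ∀ i : Fin (n + 1), frontFace h ≫ SimplexCategory.δ (finCongr h3 (Fin.natAdd (d + 1) i))
      = frontFace h1 :=
    fun i => frontFace_δ_high h h1 _ (by simp)
  have e4 : ∀ i : Fin (n + 1), backFace h ≫ SimplexCategory.δ (finCongr h3 (Fin.natAdd (d + 1) i))
      = SimplexCategory.δ i.succ ≫ backFace h1 :=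
    fun i => backFace_δ_high h h1 _ _ (by simp; omega)
  simp only [e1, e2, e3, e4, add_smul, Finset.sum_smul, smul_add, Finset.smul_sum, smul_smul]
  simp only [finCongr_apply, Fin.val_cast, Fin.val_castAdd, Fin.val_natAdd, Fin.val_castSucc,
    Fin.val_last, Fin.val_succ, Fin.val_zero, pow_zero, mul_one, pow_add, pow_one]
  have e5 : ∀ (x : ℤ), ((-1 : ℤ) ^ d * -1 * x) = - ((-1) ^ d * x) := by intro x; ring
  rw [e5, neg_smul]
  have e6 : ∀ (x : Fin (n + 1)) (y : ℤ), (-1 : ℤ) ^ d * -1 * (-1) ^ (x : ℕ) * y =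
      (-1) ^ d * (y * ((-1) ^ (x : ℕ) * -1)) := by intros; ring
  simp only [e6]
  abel


end Cap

section Relative

variable {C : Type u} [Category.{v} C] [Abelian C]

/-- In each degree, a cokernel of chain complexes is the cokernel of the components. -/
def cokernelDesc {K L : ChainComplex C ℕ} (φ : K ⟶ L) {m : ℕ} {T : C} (g : L.X m ⟶ T)
    (hg : φ.f m ≫ g = 0) : (cokernel φ).X m ⟶ T :=
  (isColimitOfHasCokernelOfPreservesColimit
    (HomologicalComplex.eval C (ComplexShape.down ℕ) m) φ).desc (CokernelCofork.ofπ g hg)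

@[simp]
lemma π_cokernelDesc {K L : ChainComplex C ℕ} (φ : K ⟶ L) {m : ℕ} {T : C} (g : L.X m ⟶ T)
    (hg : φ.f m ≫ g = 0) : (cokernel.π φ).f m ≫ cokernelDesc φ g hg = g :=
  (isColimitOfHasCokernelOfPreservesColimit
    (HomologicalComplex.eval C (ComplexShape.down ℕ) m) φ).fac (CokernelCofork.ofπ g hg)
    WalkingParallelPair.one

@[simp]
lemma π_cokernelDesc_assoc {K L : ChainComplex C ℕ} (φ : K ⟶ L) {m : ℕ} {T T' : C}
    (g : L.X m ⟶ T) (hg : φ.f m ≫ g = 0) (g' : T ⟶ T') :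
    (cokernel.π φ).f m ≫ cokernelDesc φ g hg ≫ g' = g ≫ g' := by
  rw [← Category.assoc, π_cokernelDesc]

lemma cokernel_X_hom_ext {K L : ChainComplex C ℕ} (φ : K ⟶ L) {m : ℕ} {T : C}
    {g g' : (cokernel φ).X m ⟶ T}
    (h : (cokernel.π φ).f m ≫ g = (cokernel.π φ).f m ≫ g') : g = g' := by
  have : Epi ((cokernel.π φ).f m) :=
    inferInstanceAs (Epi ((HomologicalComplex.eval C (ComplexShape.down ℕ) m).map (cokernel.π φ)))
  exact (cancel_epi _).1 h

variable [HasCoproducts.{w} C] (R : C)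

/-- Integral `d`-cochains of `X` that vanish on (the image of) `A`. -/
def relCochains {A X : SSet.{w}} (i : A ⟶ X) (d : ℕ) : AddSubgroup (X _⦋d⦌ → ℤ) where
  carrier := {c | ∀ s : A _⦋d⦌, c (i.app _ s) = 0}
  zero_mem' _ := rfl
  add_mem' ha hb s := by simp [ha s, hb s]
  neg_mem' ha s := by simp [ha s]

/-- Relative cocycles. -/
def relCocycles {A X : SSet.{w}} (i : A ⟶ X) (d : ℕ) : AddSubgroup (X _⦋d⦌ → ℤ) :=
  relCochains i d ⊓ (coboundary X d).ker

/-- Relative coboundaries: coboundaries of relative `(d - 1)`-cochains, and `0` for `d = 0`. -/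
def relCoboundaries {A X : SSet.{w}} (i : A ⟶ X) (d : ℕ) : AddSubgroup (X _⦋d⦌ → ℤ) :=
  Nat.casesOn (motive := fun d => AddSubgroup (X _⦋d⦌ → ℤ)) d ⊥
    fun e => (relCochains i e).map (coboundary X e)

variable {A X : SSet.{w}} (i : A ⟶ X)

lemma map_capChain_eq_zero {d n m : ℕ} (h : d + n = m) {c : X _⦋d⦌ → ℤ}
    (hc : c ∈ relCochains i d) :
    (SSet.chainComplexMap i R).f m ≫ capChain R X h c = 0 := by
  ext s
  have h1 := hc (A.map (frontFace h).op s)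
  rw [NatTrans.naturality_apply i (frontFace h).op s] at h1
  rw [SSet.ι_chainComplexMap_f_assoc, ι_capChain, h1, zero_smul, comp_zero]

/-- The cap product with a relative cochain, as a map `C_m(X)/C_m(A) → C_n(X)`, `m = d + n`. -/
def relCapChain {d n m : ℕ} (h : d + n = m) (c : X _⦋d⦌ → ℤ) (hc : c ∈ relCochains i d) :
    (cokernel (SSet.chainComplexMap i R)).X m ⟶ (X.chainComplex R).X n :=
  cokernelDesc _ (capChain R X h c) (map_capChain_eq_zero R i h hc)

lemma coboundary_mem_relCochains {d : ℕ} {c : X _⦋d⦌ → ℤ} (hc : c ∈ relCochains i d) :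
    coboundary X d c ∈ relCochains i (d + 1) := by
  intro s
  simp only [coboundary, AddMonoidHom.coe_mk, ZeroHom.coe_mk]
  refine Finset.sum_eq_zero fun k _ => ?_
  have h1 := hc (A.δ k s)
  have h2 : i.app _ (A.δ k s) = X.δ k (i.app _ s) := NatTrans.naturality_apply i _ s
  rw [← h2, h1, mul_zero]

lemma d_relCapChain {d n m : ℕ} (h : d + n = m) (c : X _⦋d⦌ → ℤ) (hc : c ∈ relCochains i d) :
    (cokernel (SSet.chainComplexMap i R)).d (m + 1) m ≫ relCapChain R i h c hc =
      (-1 : ℤ) ^ d • (relCapChain R i (show d + (n + 1) = m + 1 by omega) c hc ≫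
        (X.chainComplex R).d (n + 1) n) +
      relCapChain R i (show (d + 1) + n = m + 1 by omega) (coboundary X d c)
        (coboundary_mem_relCochains i hc) := by
  apply cokernel_X_hom_ext
  rw [HomologicalComplex.Hom.comm_assoc]
  simp only [relCapChain, Preadditive.comp_add, Preadditive.comp_zsmul, π_cokernelDesc,
    π_cokernelDesc_assoc]
  exact d_capChain R X h c


lemma relCapChain_d {d n m : ℕ} (h : d + (n + 1) = m + 1) (c : X _⦋d⦌ → ℤ)
    (hc : c ∈ relCocycles i d) :
    relCapChain R i h c hc.1 ≫ (X.chainComplex R).d (n + 1) n =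
      (-1 : ℤ) ^ d • ((cokernel (SSet.chainComplexMap i R)).d (m + 1) m ≫
        relCapChain R i (show d + n = m by omega) c hc.1) := by
  have h0 : coboundary X d c = 0 := hc.2
  have h1 : relCapChain R i (show (d + 1) + n = m + 1 by omega) (coboundary X d c)
      (coboundary_mem_relCochains i hc.1) = 0 := by
    apply cokernel_X_hom_ext
    rw [relCapChain, π_cokernelDesc, comp_zero]
    ext s
    rw [ι_capChain, h0, Pi.zero_apply, zero_smul, comp_zero]
  rw [d_relCapChain, h1, add_zero, smul_smul, ← mul_pow]
  simp

/-- The cap product with a relative cocycle on relative cycles. -/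
def capCycles {d n m : ℕ} (h : d + n = m) (c : X _⦋d⦌ → ℤ) (hc : c ∈ relCocycles i d) :
    (cokernel (SSet.chainComplexMap i R)).cycles m ⟶ (X.chainComplex R).cycles n :=
  (X.chainComplex R).liftCycles
    ((cokernel (SSet.chainComplexMap i R)).iCycles m ≫ relCapChain R i h c hc.1) _ rfl (by
      cases n with
      | zero => rw [HomologicalComplex.shape _ _ _ (by simp), comp_zero]
      | succ n =>
        obtain ⟨m, rfl⟩ : ∃ k, m = k + 1 := ⟨d + n, by omega⟩
        rw [ChainComplex.next_nat_succ, Category.assoc, relCapChain_d R i h c hc]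
        simp)

lemma capCycles_i {d n m : ℕ} (h : d + n = m) (c : X _⦋d⦌ → ℤ) (hc : c ∈ relCocycles i d) :
    capCycles R i h c hc ≫ (X.chainComplex R).iCycles n =
      (cokernel (SSet.chainComplexMap i R)).iCycles m ≫ relCapChain R i h c hc.1 :=
  HomologicalComplex.liftCycles_i _ _ _ _ _

lemma toCycles_capCycles {d n m : ℕ} (h : d + n = m) (c : X _⦋d⦌ → ℤ) (hc : c ∈ relCocycles i d) :
    (cokernel (SSet.chainComplexMap i R)).toCycles (m + 1) m ≫ capCycles R i h c hc ≫
      (X.chainComplex R).homologyπ n = 0 := by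
  have e : (cokernel (SSet.chainComplexMap i R)).toCycles (m + 1) m ≫ capCycles R i h c hc =
      ((-1 : ℤ) ^ d • relCapChain R i (show d + (n + 1) = m + 1 by omega) c hc.1) ≫
        (X.chainComplex R).toCycles (n + 1) n := by
    rw [← cancel_mono ((X.chainComplex R).iCycles n), Category.assoc, Category.assoc, capCycles_i,
      HomologicalComplex.toCycles_i, HomologicalComplex.toCycles_i_assoc, Preadditive.zsmul_comp,
      relCapChain_d R i _ c hc, smul_smul, ← mul_pow]
    simp
  rw [← Category.assoc, e, Category.assoc, HomologicalComplex.toCycles_comp_homologyπ, comp_zero]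

/-- The cap product `H_m(X, A) → H_n(X)` with a fixed relative `d`-cocycle, `m = d + n`. -/
def capCocycle {d n m : ℕ} (h : d + n = m) (c : X _⦋d⦌ → ℤ) (hc : c ∈ relCocycles i d) :
    (cokernel (SSet.chainComplexMap i R)).homology m ⟶ (X.chainComplex R).homology n :=
  ((cokernel (SSet.chainComplexMap i R)).homologyIsCokernel (m + 1) m (by simp)).desc
    (CokernelCofork.ofπ (capCycles R i h c hc ≫ (X.chainComplex R).homologyπ n)
      (toCycles_capCycles R i h c hc))

lemma π_capCocycle {d n m : ℕ} (h : d + n = m) (c : X _⦋d⦌ → ℤ) (hc : c ∈ relCocycles i d) :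
    (cokernel (SSet.chainComplexMap i R)).homologyπ m ≫ capCocycle R i h c hc =
      capCycles R i h c hc ≫ (X.chainComplex R).homologyπ n :=
  ((cokernel (SSet.chainComplexMap i R)).homologyIsCokernel (m + 1) m (by simp)).fac
    (CokernelCofork.ofπ (capCycles R i h c hc ≫ (X.chainComplex R).homologyπ n)
      (toCycles_capCycles R i h c hc)) WalkingParallelPair.one

lemma capCocycle_add {d n m : ℕ} (h : d + n = m) (c c' : X _⦋d⦌ → ℤ) (hc : c ∈ relCocycles i d)
    (hc' : c' ∈ relCocycles i d) :
    capCocycle R i h (c + c') (add_mem hc hc') = capCocycle R i h c hc + capCocycle R i h c' hc' := by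
  rw [← cancel_epi ((cokernel (SSet.chainComplexMap i R)).homologyπ m), Preadditive.comp_add,
    π_capCocycle, π_capCocycle, π_capCocycle, ← Preadditive.add_comp]
  congr 1
  rw [← cancel_mono ((X.chainComplex R).iCycles n), Preadditive.add_comp, capCycles_i, capCycles_i,
    capCycles_i, ← Preadditive.comp_add]
  congr 1
  apply cokernel_X_hom_ext
  rw [Preadditive.comp_add, relCapChain, relCapChain, relCapChain, π_cokernelDesc, π_cokernelDesc,
    π_cokernelDesc]
  ext s
  rw [Preadditive.comp_add, ι_capChain, ι_capChain, ι_capChain, Pi.add_apply, add_smul]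

lemma capCocycle_coboundary {d n m : ℕ} (h : d + n = m) (c : X _⦋d⦌ → ℤ)
    (hc : c ∈ relCocycles i d) (hb : c ∈ relCoboundaries i d) : capCocycle R i h c hc = 0 := by
  cases d with
  | zero =>
    obtain rfl : c = 0 := hb
    have := capCocycle_add R i h 0 0 hc hc
    simpa using this
  | succ d =>
    obtain ⟨b, hb, rfl⟩ := hb
    obtain ⟨m, rfl⟩ : ∃ k, m = k + 1 := ⟨d + n, by omega⟩
    rw [← cancel_epi ((cokernel (SSet.chainComplexMap i R)).homologyπ (m + 1)), comp_zero,
      π_capCocycle]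
    have e : capCycles R i h (coboundary X d b) hc =
        (-((-1 : ℤ) ^ d) • ((cokernel (SSet.chainComplexMap i R)).iCycles (m + 1) ≫
          relCapChain R i (show d + (n + 1) = m + 1 by omega) b hb)) ≫
        (X.chainComplex R).toCycles (n + 1) n := by
      rw [← cancel_mono ((X.chainComplex R).iCycles n), capCycles_i, Category.assoc,
        HomologicalComplex.toCycles_i, Preadditive.zsmul_comp, Category.assoc]
      have h1 := d_relCapChain R i (show d + n = m by omega) b hb
      have h2 := congrArg (fun f => (cokernel (SSet.chainComplexMap i R)).iCycles (m + 1) ≫ f) h1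
      simp only [HomologicalComplex.iCycles_d_assoc, zero_comp, Preadditive.comp_add,
        Preadditive.comp_zsmul] at h2
      rw [neg_smul]
      exact (neg_eq_of_add_eq_zero_right h2.symm).symm
    rw [e, Category.assoc, HomologicalComplex.toCycles_comp_homologyπ, comp_zero]

end Relative

/-! ### Homology and cohomology of pairs of spaces -/

section Pairs

variable {C : Type u} [Category.{v} C] [Abelian C] [HasCoproducts.{w} C] (R : C)

/-- The relative singular chain complex `C(X)/C(A)` of a pair, with coefficients in `R`. -/
def relChains : TopPair.{w} ⥤ ChainComplex C ℕ where
  obj P := cokernel (((singularChainComplexFunctor C).obj R).map P.map)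
  map {P Q} f := cokernel.map _ _ (((singularChainComplexFunctor C).obj R).map (TopPair.Hom.snd f))
    (((singularChainComplexFunctor C).obj R).map (TopPair.Hom.fst f)) (by
      rw [← Functor.map_comp, ← Functor.map_comp, TopPair.Hom.w])
  map_id P := by
    rw [← cancel_epi (cokernel.π _), cokernel.π_desc]
    erw [CategoryTheory.Functor.map_id, Category.id_comp, Category.comp_id]
  map_comp f g := by
    rw [← cancel_epi (cokernel.π _), cokernel.π_desc, cokernel.π_desc_assoc, Category.assoc,
      cokernel.π_desc]
    erw [CategoryTheory.Functor.map_comp, Category.assoc]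

/-- Relative singular homology `H_n(X, A; R)`. -/
def relHomology (n : ℕ) : TopPair.{w} ⥤ C :=
  relChains R ⋙ HomologicalComplex.homologyFunctor C _ n

/-- The canonical map `H_n(X; R) → H_n(X, A; R)`. -/
def toRelHomology (n : ℕ) (P : TopPair.{w}) :
    ((singularHomologyFunctor C n).obj R).obj P.fst ⟶ (relHomology R n).obj P :=
  HomologicalComplex.homologyMap
    (cokernel.π (((singularChainComplexFunctor C).obj R).map P.map)) n

/-- Relative singular cohomology `H^d(X, A; ℤ)`. -/
def relCohomology (d : ℕ) (P : TopPair.{w}) : Type w :=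
  relCocycles (TopCat.toSSet.map P.map) d ⧸
    (relCoboundaries (TopCat.toSSet.map P.map) d).addSubgroupOf
      (relCocycles (TopCat.toSSet.map P.map) d)

instance (d : ℕ) (P : TopPair.{w}) : AddCommGroup (relCohomology d P) :=
  inferInstanceAs (AddCommGroup (_ ⧸ _))

variable {P Q : TopPair.{w}}

/-- The pull-back of cochains. -/
def pullCochain (f : P ⟶ Q) (d : ℕ) : ((TopCat.toSSet.obj Q.fst) _⦋d⦌ → ℤ) →+
    ((TopCat.toSSet.obj P.fst) _⦋d⦌ → ℤ) where
  toFun c s := c ((TopCat.toSSet.map (TopPair.Hom.fst f)).app _ s)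
  map_zero' := rfl
  map_add' _ _ := rfl

lemma coboundary_pullCochain (f : P ⟶ Q) (d : ℕ) (c : (TopCat.toSSet.obj Q.fst) _⦋d⦌ → ℤ) :
    coboundary _ d (pullCochain f d c) = pullCochain f (d + 1) (coboundary _ d c) := by
  ext s
  simp only [coboundary, pullCochain, AddMonoidHom.coe_mk, ZeroHom.coe_mk]
  refine Finset.sum_congr rfl fun i _ => ?_
  congr 2

lemma pullCochain_mem_relCochains (f : P ⟶ Q) (d : ℕ) {c : (TopCat.toSSet.obj Q.fst) _⦋d⦌ → ℤ}
    (hc : c ∈ relCochains (TopCat.toSSet.map Q.map) d) :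
    pullCochain f d c ∈ relCochains (TopCat.toSSet.map P.map) d := by
  intro s
  have h := hc ((TopCat.toSSet.map (TopPair.Hom.snd f)).app _ s)
  have e : TopCat.toSSet.map (TopPair.Hom.snd f) ≫ TopCat.toSSet.map Q.map =
      TopCat.toSSet.map P.map ≫ TopCat.toSSet.map (TopPair.Hom.fst f) := by
    rw [← Functor.map_comp, ← Functor.map_comp, TopPair.Hom.w]
  have e' := ConcreteCategory.congr_hom (NatTrans.congr_app e (Opposite.op ⦋d⦌)) s
  simp only [pullCochain, AddMonoidHom.coe_mk, ZeroHom.coe_mk]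
  exact (congrArg c e').symm.trans h

lemma pullCochain_mem_relCocycles (f : P ⟶ Q) (d : ℕ) {c : (TopCat.toSSet.obj Q.fst) _⦋d⦌ → ℤ}
    (hc : c ∈ relCocycles (TopCat.toSSet.map Q.map) d) :
    pullCochain f d c ∈ relCocycles (TopCat.toSSet.map P.map) d := by
  refine ⟨pullCochain_mem_relCochains f d hc.1, ?_⟩
  have h : coboundary _ d c = 0 := hc.2
  change coboundary _ d (pullCochain f d c) = 0
  rw [coboundary_pullCochain, h, map_zero]

lemma pullCochain_mem_relCoboundaries (f : P ⟶ Q) (d : ℕ)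
    {c : (TopCat.toSSet.obj Q.fst) _⦋d⦌ → ℤ}
    (hc : c ∈ relCoboundaries (TopCat.toSSet.map Q.map) d) :
    pullCochain f d c ∈ relCoboundaries (TopCat.toSSet.map P.map) d := by
  cases d with
  | zero =>
    obtain rfl : c = 0 := hc
    exact (relCoboundaries _ 0).zero_mem
  | succ d =>
    obtain ⟨b, hb, rfl⟩ := hc
    exact ⟨pullCochain f d b, pullCochain_mem_relCochains f d hb, coboundary_pullCochain f d b⟩

/-- The map induced in relative cohomology by a map of pairs. -/
def cohomologyMap (d : ℕ) (f : P ⟶ Q) : relCohomology d Q →+ relCohomology d P :=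
  QuotientAddGroup.map _ _
    (((pullCochain f d).comp (relCocycles _ d).subtype).codRestrict (relCocycles _ d)
      fun c => pullCochain_mem_relCocycles f d c.2)
    fun _ hc => pullCochain_mem_relCoboundaries f d hc

/-- The cap product `H^d(X, A; ℤ) ⊗ H_{d+n}(X, A; R) → H_n(X; R)`. -/
def cap (d n : ℕ) (P : TopPair.{w}) :
    relCohomology d P →+
      ((relHomology R (d + n)).obj P ⟶ ((singularHomologyFunctor C n).obj R).obj P.fst) :=
  QuotientAddGroup.lift _
    { toFun := fun c => capCocycle R (TopCat.toSSet.map P.map) rfl c.1 c.2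
      map_zero' := capCocycle_coboundary R _ rfl _ _ (zero_mem _)
      map_add' := fun a b => capCocycle_add R _ rfl a.1 b.1 a.2 b.2 }
    fun _ hc => capCocycle_coboundary R _ rfl _ _ hc

end Pairs
/-! ### Square integrable derivatives on `[0, 1]` -/

section L2

/-- The Hilbert space `L²([0, 1])`. -/
abbrev L2 : Type := Lp ℝ 2 (volume.restrict (Set.Ioc (0 : ℝ) 1))

/-- `g` lies in the Sobolev space `H¹([0, 1])` with weak derivative `h`: it is a primitive of the
square integrable function `h`. -/
def HasL2Deriv (g : I → ℝ) (h : L2) : Prop :=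
  ∀ t : I, g t = g 0 + ∫ s in (0 : ℝ)..t, h s

lemma L2.intervalIntegrable (h : L2) {a b : ℝ} (ha : 0 ≤ a) (hab : a ≤ b) (hb : b ≤ 1) :
    IntervalIntegrable h volume a b := by
  have h1 : Integrable h (volume.restrict (Set.Ioc (0 : ℝ) 1)) :=
    (Lp.memLp h).integrable one_le_two
  rw [intervalIntegrable_iff_integrableOn_Ioc_of_le hab]
  exact IntegrableOn.mono_set h1 (Set.Ioc_subset_Ioc ha hb)

lemma HasL2Deriv.unique {g : I → ℝ} {h h' : L2} (H : HasL2Deriv g h) (H' : HasL2Deriv g h') :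
    h = h' := by
  have key : ∀ t ∈ Set.Icc (0 : ℝ) 1, ∫ s in (0 : ℝ)..t, h s = ∫ s in (0 : ℝ)..t, h' s :=
    fun t ht => add_left_cancel ((H ⟨t, ht⟩).symm.trans (H' ⟨t, ht⟩))
  apply Lp.ext
  rw [Filter.EventuallyEq, ae_restrict_iff' measurableSet_Ioc]
  have i1 := (h.intervalIntegrable le_rfl zero_le_one le_rfl).ae_hasDerivAt_integral
  have i2 := (h'.intervalIntegrable le_rfl zero_le_one le_rfl).ae_hasDerivAt_integral
  have i3 : ∀ᵐ x : ℝ, x ≠ 1 := by simp [ae_iff, measure_singleton]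
  filter_upwards [i1, i2, i3] with x h1 h2 h3 hx
  rw [Set.uIcc_of_le zero_le_one] at h1 h2
  have hx' : x ∈ Set.Icc (0 : ℝ) 1 := ⟨hx.1.le, hx.2⟩
  have d1 := h1 hx' 0 (by simp)
  have d2 := h2 hx' 0 (by simp)
  have hn : Set.Icc (0 : ℝ) 1 ∈ nhds x := Icc_mem_nhds hx.1 (lt_of_le_of_ne hx.2 h3)
  refine d1.unique (d2.congr_of_eventuallyEq ?_)
  filter_upwards [hn] with t ht using key t ht

variable (c e : ℝ) (U : Set ℝ)

lemma measurable_affine : Measurable fun s : ℝ => c * s + e := by fun_prop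

lemma map_affine (hc : 0 < c) (hU : MeasurableSet U) (hU1 : U ⊆ Set.Ioc 0 1)
    (hT : (fun s : ℝ => c * s + e) ⁻¹' U ⊆ Set.Ioc 0 1) :
    Measure.map (fun s : ℝ => c * s + e) ((volume.restrict (Set.Ioc (0 : ℝ) 1)).restrict
      ((fun s : ℝ => c * s + e) ⁻¹' U)) ≤
      ENNReal.ofReal c⁻¹ • volume.restrict (Set.Ioc (0 : ℝ) 1) := by
  rw [Measure.restrict_restrict_of_subset hT, ← Measure.restrict_map (measurable_affine c e) hU]
  have h1 : Measure.map (fun s : ℝ => c * s + e) volume = ENNReal.ofReal c⁻¹ • volume := by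
    have : (fun s : ℝ => c * s + e) = (fun s => s + e) ∘ (fun s => c * s) := rfl
    rw [this, ← Measure.map_map (by fun_prop) (by fun_prop), Real.map_volume_mul_left hc.ne',
      Measure.map_smul, map_add_right_eq_self, abs_of_pos (inv_pos.2 hc)]
  rw [h1, Measure.restrict_smul]
  gcongr


lemma memLp_affine (hc : 0 < c) (hU : MeasurableSet U) (hU1 : U ⊆ Set.Ioc 0 1)
    (hT : (fun s : ℝ => c * s + e) ⁻¹' U ⊆ Set.Ioc 0 1) (h : L2) :
    MemLp (((fun s : ℝ => c * s + e) ⁻¹' U).indicator fun s => h (c * s + e)) 2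
      (volume.restrict (Set.Ioc (0 : ℝ) 1)) := by
  rw [memLp_indicator_iff_restrict (measurable_affine c e hU)]
  have h1 : MemLp h 2 (Measure.map (fun s : ℝ => c * s + e)
      ((volume.restrict (Set.Ioc (0 : ℝ) 1)).restrict ((fun s : ℝ => c * s + e) ⁻¹' U))) :=
    (Lp.memLp h).of_measure_le_smul ENNReal.ofReal_ne_top (map_affine c e U hc hU hU1 hT)
  exact h1.comp_of_map (measurable_affine c e).aemeasurable

lemma eLpNorm_affine_le (hc : 0 < c) (hU : MeasurableSet U) (hU1 : U ⊆ Set.Ioc 0 1)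
    (hT : (fun s : ℝ => c * s + e) ⁻¹' U ⊆ Set.Ioc 0 1) (h : L2) :
    eLpNorm (((fun s : ℝ => c * s + e) ⁻¹' U).indicator fun s => h (c * s + e)) 2
      (volume.restrict (Set.Ioc (0 : ℝ) 1)) ≤
      ENNReal.ofReal c⁻¹ ^ (1 / 2 : ℝ) * eLpNorm h 2 (volume.restrict (Set.Ioc (0 : ℝ) 1)) := by
  have hm := map_affine c e U hc hU hU1 hT
  rw [eLpNorm_indicator_eq_eLpNorm_restrict (measurable_affine c e hU)]
  have h1 : AEStronglyMeasurable h (Measure.map (fun s : ℝ => c * s + e)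
      ((volume.restrict (Set.Ioc (0 : ℝ) 1)).restrict ((fun s : ℝ => c * s + e) ⁻¹' U))) :=
    ((Lp.memLp h).of_measure_le_smul ENNReal.ofReal_ne_top hm).1
  have h2 := eLpNorm_map_measure (p := 2) h1 (measurable_affine c e).aemeasurable
  refine (h2.symm.trans_le (eLpNorm_mono_measure _ hm)).trans ?_
  rw [eLpNorm_smul_measure_of_ne_top (by simp)]
  simp

lemma ae_eq_affine (hc : 0 < c) (hU : MeasurableSet U) (hU1 : U ⊆ Set.Ioc 0 1)
    (hT : (fun s : ℝ => c * s + e) ⁻¹' U ⊆ Set.Ioc 0 1) {f g : ℝ → ℝ}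
    (hfg : f =ᵐ[volume.restrict (Set.Ioc (0 : ℝ) 1)] g) :
    (((fun s : ℝ => c * s + e) ⁻¹' U).indicator fun s => f (c * s + e))
      =ᵐ[volume.restrict (Set.Ioc (0 : ℝ) 1)]
    (((fun s : ℝ => c * s + e) ⁻¹' U).indicator fun s => g (c * s + e)) := by
  have hm := map_affine c e U hc hU hU1 hT
  have h1 := ae_of_ae_map (measurable_affine c e).aemeasurable
    ((Measure.absolutelyContinuous_of_le_smul hm).ae_le hfg)
  rw [ae_restrict_iff' (measurable_affine c e hU)] at h1
  filter_upwards [h1] with s hs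
  by_cases hsU : s ∈ (fun s : ℝ => c * s + e) ⁻¹' U
  · rw [Set.indicator_of_mem hsU, Set.indicator_of_mem hsU]
    exact hs hsU
  · rw [Set.indicator_of_notMem hsU, Set.indicator_of_notMem hsU]

/-- Substitution of an affine map in an `L²` function, cut off by zero. -/
def substL2 (hc : 0 < c) (hU : MeasurableSet U) (hU1 : U ⊆ Set.Ioc 0 1)
    (hT : (fun s : ℝ => c * s + e) ⁻¹' U ⊆ Set.Ioc 0 1) : L2 →L[ℝ] L2 :=
  LinearMap.mkContinuous
    { toFun := fun h => (memLp_affine c e U hc hU hU1 hT h).toLp _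
      map_add' := fun h h' => by
        rw [← MemLp.toLp_add]
        apply MemLp.toLp_congr
        refine (ae_eq_affine c e U hc hU hU1 hT (Lp.coeFn_add h h')).trans (.of_forall fun s => ?_)
        by_cases hs : s ∈ (fun s : ℝ => c * s + e) ⁻¹' U
        · simp only [Pi.add_apply, Set.indicator_of_mem hs]
        · simp only [Pi.add_apply, Set.indicator_of_notMem hs, add_zero]
      map_smul' := fun r h => by
        rw [RingHom.id_apply, ← MemLp.toLp_const_smul]
        apply MemLp.toLp_congr
        refine (ae_eq_affine c e U hc hU hU1 hT (Lp.coeFn_smul r h)).trans (.of_forall fun s => ?_)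
        by_cases hs : s ∈ (fun s : ℝ => c * s + e) ⁻¹' U
        · simp only [Pi.smul_apply, Set.indicator_of_mem hs]
        · simp only [Pi.smul_apply, Set.indicator_of_notMem hs, smul_zero] }
    (ENNReal.ofReal c⁻¹ ^ (1 / 2 : ℝ)).toReal
    fun h => by
      change ‖(memLp_affine c e U hc hU hU1 hT h).toLp _‖ ≤ _
      rw [Lp.norm_toLp, Lp.norm_def, ← ENNReal.toReal_mul]
      refine ENNReal.toReal_mono ?_ (eLpNorm_affine_le c e U hc hU hU1 hT h)
      exact ENNReal.mul_ne_top (ENNReal.rpow_ne_top_of_nonneg (by norm_num) ENNReal.ofReal_ne_top)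
        (Lp.memLp h).2.ne

lemma substL2_ae (hc : 0 < c) (hU : MeasurableSet U) (hU1 : U ⊆ Set.Ioc 0 1)
    (hT : (fun s : ℝ => c * s + e) ⁻¹' U ⊆ Set.Ioc 0 1) (h : L2) :
    substL2 c e U hc hU hU1 hT h =ᵐ[volume.restrict (Set.Ioc (0 : ℝ) 1)]
      (((fun s : ℝ => c * s + e) ⁻¹' U).indicator fun s => h (c * s + e)) :=
  MemLp.coeFn_toLp (memLp_affine c e U hc hU hU1 hT h)

/-- On an interval on which the affine map takes values in `U`, up to the left end. -/
lemma integral_substL2 (hc : 0 < c) (hU : MeasurableSet U) (hU1 : U ⊆ Set.Ioc 0 1)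
    (hT : (fun s : ℝ => c * s + e) ⁻¹' U ⊆ Set.Ioc 0 1) (h : L2) {a b : ℝ} (ha : 0 ≤ a)
    (hab : a ≤ b) (hb : b ≤ 1) (hs : ∀ s ∈ Set.Ioc a b, c * s + e ∈ U) :
    ∫ s in a..b, substL2 c e U hc hU hU1 hT h s = c⁻¹ * ∫ s in (c * a + e)..(c * b + e), h s := by
  have h1 := substL2_ae c e U hc hU hU1 hT h
  rw [Filter.EventuallyEq, ae_restrict_iff' measurableSet_Ioc] at h1
  rw [← smul_eq_mul, ← intervalIntegral.integral_comp_mul_add _ hc.ne']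
  refine intervalIntegral.integral_congr_ae ?_
  rw [Set.uIoc_of_le hab]
  filter_upwards [h1] with s h1 hsab
  rw [h1 ⟨ha.trans_lt hsab.1, hsab.2.trans hb⟩, Set.indicator_of_mem
    (show s ∈ (fun s : ℝ => c * s + e) ⁻¹' U from hs s hsab)]

lemma integral_substL2_eq_zero (hc : 0 < c) (hU : MeasurableSet U) (hU1 : U ⊆ Set.Ioc 0 1)
    (hT : (fun s : ℝ => c * s + e) ⁻¹' U ⊆ Set.Ioc 0 1) (h : L2) {a b : ℝ} (ha : 0 ≤ a)
    (hab : a ≤ b) (hb : b ≤ 1) (hs : ∀ s ∈ Set.Ioc a b, c * s + e ∉ U) :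
    ∫ s in a..b, substL2 c e U hc hU hU1 hT h s = 0 := by
  have h1 := substL2_ae c e U hc hU hU1 hT h
  rw [Filter.EventuallyEq, ae_restrict_iff' measurableSet_Ioc] at h1
  refine intervalIntegral.integral_zero_ae ?_
  rw [Set.uIoc_of_le hab]
  filter_upwards [h1] with s h1 hsab
  rw [h1 ⟨ha.trans_lt hsab.1, hsab.2.trans hb⟩, Set.indicator_of_notMem
    (show s ∉ (fun s : ℝ => c * s + e) ⁻¹' U from hs s hsab)]

end L2

section Derivatives

/-- `a(2 s)` for `s ≤ 1/2`, and `0` afterwards. -/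
def firstHalf : L2 →L[ℝ] L2 :=
  substL2 2 0 (Set.Ioc 0 1) (by norm_num) measurableSet_Ioc subset_rfl
    (fun s hs => ⟨by linarith [hs.1], by linarith [hs.2]⟩)

/-- `b(2 s - 1)` for `s > 1/2`, and `0` before. -/
def secondHalf : L2 →L[ℝ] L2 :=
  substL2 2 (-1) (Set.Ioc 0 1) (by norm_num) measurableSet_Ioc subset_rfl
    (fun s hs => ⟨by linarith [hs.1], by linarith [hs.2]⟩)

/-- `h(s / 2)`. -/
def stretchFirst : L2 →L[ℝ] L2 :=
  substL2 2⁻¹ 0 (Set.Ioc 0 2⁻¹) (by norm_num) measurableSet_Ioc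
    (Set.Ioc_subset_Ioc le_rfl (by norm_num))
    (fun s hs => ⟨by linarith [hs.1], by linarith [hs.2]⟩)

/-- `h(1/2 + s / 2)`. -/
def stretchSecond : L2 →L[ℝ] L2 :=
  substL2 2⁻¹ 2⁻¹ (Set.Ioc 2⁻¹ 1) (by norm_num) measurableSet_Ioc
    (Set.Ioc_subset_Ioc (by norm_num) le_rfl)
    (fun s hs => ⟨by linarith [hs.1], by linarith [hs.2]⟩)

lemma hasL2Deriv_concat {g g₁ g₂ : I → ℝ} {h₁ h₂ : L2} (H₁ : HasL2Deriv g₁ h₁)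
    (H₂ : HasL2Deriv g₂ h₂) (h12 : g₁ 1 = g₂ 0)
    (hg₁ : ∀ t : I, ∀ ht : (t : ℝ) ≤ 1 / 2,
      g t = g₁ ⟨2 * t, unitInterval.mul_pos_mem_iff zero_lt_two |>.2 ⟨t.2.1, ht⟩⟩)
    (hg₂ : ∀ t : I, ∀ ht : ¬ (t : ℝ) ≤ 1 / 2,
      g t = g₂ ⟨2 * t - 1, unitInterval.two_mul_sub_one_mem_iff.2 ⟨(not_le.1 ht).le, t.2.2⟩⟩) :
    HasL2Deriv g ((2 : ℝ) • (firstHalf h₁ + secondHalf h₂)) := by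
  have hg0 : g 0 = g₁ 0 := by
    rw [hg₁ 0 (by simp)]
    congr 1
    ext
    simp
  have hint : ∀ t : I, ∫ s in (0 : ℝ)..t, ((2 : ℝ) • (firstHalf h₁ + secondHalf h₂) : L2) s =
      2 * ((∫ s in (0 : ℝ)..t, firstHalf h₁ s) + ∫ s in (0 : ℝ)..t, secondHalf h₂ s) := by
    intro t
    rw [← intervalIntegral.integral_add
      (L2.intervalIntegrable _ le_rfl t.2.1 t.2.2) (L2.intervalIntegrable _ le_rfl t.2.1 t.2.2),
      ← intervalIntegral.integral_const_mul]
    refine intervalIntegral.integral_congr_ae ?_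
    have h1 := Lp.coeFn_smul (2 : ℝ) (firstHalf h₁ + secondHalf h₂)
    have h2 := Lp.coeFn_add (firstHalf h₁) (secondHalf h₂)
    rw [Filter.EventuallyEq, ae_restrict_iff' measurableSet_Ioc] at h1 h2
    rw [Set.uIoc_of_le t.2.1]
    filter_upwards [h1, h2] with s h1 h2 hs
    have hs' : s ∈ Set.Ioc (0 : ℝ) 1 := ⟨hs.1, hs.2.trans t.2.2⟩
    rw [h1 hs', Pi.smul_apply, h2 hs', Pi.add_apply, smul_eq_mul]
  intro t
  rw [hint]
  by_cases ht : (t : ℝ) ≤ 1 / 2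
  · rw [hg₁ t ht, hg0, H₁]
    have e1 : ∫ s in (0 : ℝ)..t, firstHalf h₁ s = 2⁻¹ * ∫ s in (2 * 0 + 0 : ℝ)..(2 * t + 0), h₁ s :=
      integral_substL2 _ _ _ _ _ _ _ h₁ le_rfl t.2.1 t.2.2
        (fun s hs => ⟨by linarith [hs.1], by linarith [hs.2]⟩)
    have e2 : ∫ s in (0 : ℝ)..t, secondHalf h₂ s = 0 :=
      integral_substL2_eq_zero _ _ _ _ _ _ _ h₂ le_rfl t.2.1 t.2.2
        (fun s hs hs' => by linarith [hs.2, hs'.1])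
    rw [e1, e2]
    simp
  · have ht' : 1 / 2 ≤ (t : ℝ) := (not_le.1 ht).le
    rw [hg₂ t ht, hg0, H₂, ← h12, H₁]
    have e1 : ∫ s in (0 : ℝ)..t, firstHalf h₁ s = 2⁻¹ * ∫ s in (0 : ℝ)..1, h₁ s := by
      rw [← intervalIntegral.integral_add_adjacent_intervals (b := 1 / 2)
        (L2.intervalIntegrable _ le_rfl (by norm_num) (by norm_num))
        (L2.intervalIntegrable _ (by norm_num) ht' t.2.2)]
      have f1 : ∫ s in (0 : ℝ)..(1 / 2), firstHalf h₁ s =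
          2⁻¹ * ∫ s in (2 * 0 + 0 : ℝ)..(2 * (1 / 2) + 0), h₁ s :=
        integral_substL2 _ _ _ _ _ _ _ h₁ le_rfl (by norm_num) (by norm_num)
          (fun s hs => ⟨by linarith [hs.1], by linarith [hs.2]⟩)
      have f2 : ∫ s in (1 / 2 : ℝ)..t, firstHalf h₁ s = 0 :=
        integral_substL2_eq_zero _ _ _ _ _ _ _ h₁ (by norm_num) ht' t.2.2
          (fun s hs hs' => by linarith [hs.1, hs'.2])
      rw [f1, f2]
      norm_num
    have e2 : ∫ s in (0 : ℝ)..t, secondHalf h₂ s = 2⁻¹ * ∫ s in (0 : ℝ)..(2 * t - 1), h₂ s := by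
      rw [← intervalIntegral.integral_add_adjacent_intervals (b := 1 / 2)
        (L2.intervalIntegrable _ le_rfl (by norm_num) (by norm_num))
        (L2.intervalIntegrable _ (by norm_num) ht' t.2.2)]
      have f1 : ∫ s in (0 : ℝ)..(1 / 2), secondHalf h₂ s = 0 :=
        integral_substL2_eq_zero _ _ _ _ _ _ _ h₂ le_rfl (by norm_num) (by norm_num)
          (fun s hs hs' => by linarith [hs.2, hs'.1])
      have f2 : ∫ s in (1 / 2 : ℝ)..t, secondHalf h₂ s =
          2⁻¹ * ∫ s in (2 * (1 / 2) + -1 : ℝ)..(2 * t + -1), h₂ s :=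
        integral_substL2 _ _ _ _ _ _ _ h₂ (by norm_num) ht' t.2.2
          (fun s hs => ⟨by linarith [hs.1], by linarith [hs.2, t.2.2]⟩)
      rw [f1, f2]
      norm_num [sub_eq_add_neg]
    rw [e1, e2]
    simp
    ring

lemma hasL2Deriv_stretchFirst {g g' : I → ℝ} {h : L2} (H : HasL2Deriv g h)
    (hg : ∀ t s : I, (s : ℝ) = t / 2 → g' t = g s) :
    HasL2Deriv g' ((2⁻¹ : ℝ) • stretchFirst h) := by
  intro t
  have h0 : g' 0 = g 0 := hg 0 0 (by simp)
  have hmem : (t : ℝ) / 2 ∈ I := ⟨by linarith [t.2.1], by linarith [t.2.2]⟩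
  have hint : ∫ s in (0 : ℝ)..t, ((2⁻¹ : ℝ) • stretchFirst h : L2) s =
      2⁻¹ * ∫ s in (0 : ℝ)..t, stretchFirst h s := by
    rw [← intervalIntegral.integral_const_mul]
    refine intervalIntegral.integral_congr_ae ?_
    have h1 := Lp.coeFn_smul (2⁻¹ : ℝ) (stretchFirst h)
    rw [Filter.EventuallyEq, ae_restrict_iff' measurableSet_Ioc] at h1
    rw [Set.uIoc_of_le t.2.1]
    filter_upwards [h1] with s h1 hs
    rw [h1 ⟨hs.1, hs.2.trans t.2.2⟩, Pi.smul_apply, smul_eq_mul]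
  have e1 : ∫ s in (0 : ℝ)..t, stretchFirst h s =
      (2⁻¹)⁻¹ * ∫ s in (2⁻¹ * 0 + 0 : ℝ)..(2⁻¹ * t + 0), h s :=
    integral_substL2 _ _ _ _ _ _ _ h le_rfl t.2.1 t.2.2
      (fun s hs => ⟨by linarith [hs.1], by linarith [hs.2, t.2.2]⟩)
  rw [hg t ⟨t / 2, hmem⟩ rfl, h0, H, hint, e1]
  simp [div_eq_inv_mul]

lemma hasL2Deriv_stretchSecond {g g' : I → ℝ} {h : L2} (H : HasL2Deriv g h)
    (hg : ∀ t s : I, (s : ℝ) = 1 / 2 + t / 2 → g' t = g s) :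
    HasL2Deriv g' ((2⁻¹ : ℝ) • stretchSecond h) := by
  intro t
  have hmem0 : (1 / 2 : ℝ) ∈ I := ⟨by norm_num, by norm_num⟩
  have h0 : g' 0 = g ⟨1 / 2, hmem0⟩ := hg 0 _ (by simp)
  have hmem : 1 / 2 + (t : ℝ) / 2 ∈ I := ⟨by linarith [t.2.1], by linarith [t.2.2]⟩
  have hint : ∫ s in (0 : ℝ)..t, ((2⁻¹ : ℝ) • stretchSecond h : L2) s =
      2⁻¹ * ∫ s in (0 : ℝ)..t, stretchSecond h s := by
    rw [← intervalIntegral.integral_const_mul]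
    refine intervalIntegral.integral_congr_ae ?_
    have h1 := Lp.coeFn_smul (2⁻¹ : ℝ) (stretchSecond h)
    rw [Filter.EventuallyEq, ae_restrict_iff' measurableSet_Ioc] at h1
    rw [Set.uIoc_of_le t.2.1]
    filter_upwards [h1] with s h1 hs
    rw [h1 ⟨hs.1, hs.2.trans t.2.2⟩, Pi.smul_apply, smul_eq_mul]
  have e1 : ∫ s in (0 : ℝ)..t, stretchSecond h s =
      (2⁻¹)⁻¹ * ∫ s in (2⁻¹ * 0 + 2⁻¹ : ℝ)..(2⁻¹ * t + 2⁻¹), h s :=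
    integral_substL2 _ _ _ _ _ _ _ h le_rfl t.2.1 t.2.2
      (fun s hs => ⟨by linarith [hs.1], by linarith [hs.2, t.2.2]⟩)
  have e2 : (2⁻¹ * t + 2⁻¹ : ℝ) = 1 / 2 + t / 2 := by ring
  have e3 := intervalIntegral.integral_add_adjacent_intervals (b := 1 / 2) (c := 1 / 2 + (t : ℝ) / 2)
        (L2.intervalIntegrable h le_rfl (by norm_num) (by norm_num))
        (L2.intervalIntegrable h (by norm_num) (by linarith [t.2.1]) hmem.2)
  rw [hg t ⟨1 / 2 + t / 2, hmem⟩ rfl, h0, H, H ⟨1 / 2, hmem0⟩, hint, e1, e2, ← e3]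
  norm_num
  ring

end Derivatives

/-! ### Free loops -/

section Loops

variable (d : ℕ) (M : Type w) [TopologicalSpace M] [ChartedSpace (EuclideanSpace ℝ (Fin d)) M]

/-- The free loop space `LM` of a smooth manifold `M`, in its Hilbert manifold model: loops of
Sobolev class `H¹`, that is, continuous loops `γ : [0, 1] → M`, `γ(0) = γ(1)`, such that `f ∘ γ` is
in `H¹` for all smooth functions `f` on `M`. -/
def LoopSpace : Type w :=
  {γ : C(I, M) // γ 0 = γ 1 ∧ ∀ f : C^∞⟮𝓡 d, M; 𝓘(ℝ, ℝ), ℝ⟯, ∃ h : L2, HasL2Deriv (f ∘ γ) h}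

namespace LoopSpace

variable {d M}

/-- The (unique) `L²` derivative of `f ∘ γ`. -/
def derivL2 (γ : LoopSpace d M) (f : C^∞⟮𝓡 d, M; 𝓘(ℝ, ℝ), ℝ⟯) : L2 :=
  Classical.choose (γ.2.2 f)

lemma hasL2Deriv (γ : LoopSpace d M) (f : C^∞⟮𝓡 d, M; 𝓘(ℝ, ℝ), ℝ⟯) :
    HasL2Deriv (f ∘ γ.1) (γ.derivL2 f) :=
  Classical.choose_spec (γ.2.2 f)

lemma derivL2_eq {γ : LoopSpace d M} {f : C^∞⟮𝓡 d, M; 𝓘(ℝ, ℝ), ℝ⟯} {h : L2}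
    (H : HasL2Deriv (f ∘ γ.1) h) : γ.derivL2 f = h :=
  (γ.hasL2Deriv f).unique H

/-- The `H¹` topology on `LM`: uniform convergence of the loops, together with `L²` convergence of
the derivatives of `f ∘ γ` for every smooth function `f`. For compact `M` this is the topology
induced from `H¹([0, 1], ℝᴺ)` by any smooth embedding of `M` in a Euclidean space `ℝᴺ`. -/
instance : TopologicalSpace (LoopSpace d M) :=
  TopologicalSpace.induced
    (fun γ => ((γ.1, γ.derivL2) : C(I, M) × (C^∞⟮𝓡 d, M; 𝓘(ℝ, ℝ), ℝ⟯ → L2))) inferInstance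

lemma continuous_iff {T : Type*} [TopologicalSpace T] {F : T → LoopSpace d M} :
    Continuous F ↔ Continuous (fun x => (F x).1) ∧ ∀ f, Continuous fun x => (F x).derivL2 f := by
  rw [continuous_induced_rng]
  exact continuous_prodMk.trans (and_congr Iff.rfl continuous_pi_iff)

lemma continuous_val : Continuous fun γ : LoopSpace d M => γ.1 :=
  (continuous_iff.1 continuous_id).1

lemma continuous_derivL2 (f : C^∞⟮𝓡 d, M; 𝓘(ℝ, ℝ), ℝ⟯) :
    Continuous fun γ : LoopSpace d M => γ.derivL2 f :=
  (continuous_iff.1 continuous_id).2 f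

/-- Evaluation of loops at time `t`. -/
def ev (t : I) : C(LoopSpace d M, M) where
  toFun γ := γ.1 t
  continuous_toFun := (continuous_eval_const t).comp continuous_val

end LoopSpace

/-- The point `1/2` of `[0, 1]`. -/
def half : I := ⟨1 / 2, by norm_num, by norm_num⟩

/-- The map `ev(0) × ev(1/2) : LM → M × M`. -/
def evPair : C(LoopSpace d M, M × M) := (LoopSpace.ev 0).prodMk (LoopSpace.ev half)

/-- The subset `L_{1/2} M = {η | η(1/2) = η(0)}` of `LM`. -/
def halfSet : Set (LoopSpace d M) := {η | LoopSpace.ev half η = LoopSpace.ev 0 η}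

/-- The space `L_{1/2} M`. -/
abbrev HalfLoops : Type w := halfSet d M

/-- The space `LM ×_M LM` of pairs of loops with the same base point. -/
abbrev Composable : Type w :=
  {p : LoopSpace d M × LoopSpace d M // LoopSpace.ev 0 p.1 = LoopSpace.ev 0 p.2}

/-- The inclusion `j̃ : L_{1/2} M → LM`. -/
def inclHalf : C(HalfLoops d M, LoopSpace d M) := ⟨Subtype.val, continuous_subtype_val⟩

/-- The inclusion `Δ̃ : LM ×_M LM → LM × LM`. -/
def inclComposable : C(Composable d M, LoopSpace d M × LoopSpace d M) :=
  ⟨Subtype.val, continuous_subtype_val⟩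

variable {d M}

/-- A loop as a path. -/
def pathOf (γ : LoopSpace d M) : Path (γ.1 0) (γ.1 1) := ⟨γ.1, rfl, rfl⟩

/-- The second loop of a composable pair, as a path from the end point of the first one. -/
def pathOf' (p : Composable d M) : Path (p.1.1.1 1) (p.1.2.1 1) :=
  ⟨p.1.2.1, p.2.symm.trans p.1.1.2.1, rfl⟩

/-- The underlying path of `α * β`. -/
def concatPath (p : Composable d M) : Path (p.1.1.1 0) (p.1.2.1 1) :=
  (pathOf p.1.1).trans (pathOf' p)

lemma hasL2Deriv_concatPath (p : Composable d M) (f : C^∞⟮𝓡 d, M; 𝓘(ℝ, ℝ), ℝ⟯) :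
    HasL2Deriv (f ∘ concatPath p)
      ((2 : ℝ) • (firstHalf (p.1.1.derivL2 f) + secondHalf (p.1.2.derivL2 f))) := by
  refine hasL2Deriv_concat (p.1.1.hasL2Deriv f) (p.1.2.hasL2Deriv f) ?_ ?_ ?_
  · exact congrArg f (p.1.1.2.1.symm.trans p.2)
  · intro t ht
    simp only [Function.comp_apply, concatPath, Path.trans_apply, dif_pos ht]
    rfl
  · intro t ht
    simp only [Function.comp_apply, concatPath, Path.trans_apply, dif_neg ht]
    rfl

/-- The composition `α * β` of loops: `α(2t)` for `t ≤ 1/2`, and `β(2t - 1)` for `t ≥ 1/2`. -/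
def concat (p : Composable d M) : LoopSpace d M :=
  ⟨(concatPath p : C(I, M)), by
    change concatPath p 0 = concatPath p 1
    rw [Path.source, Path.target]
    exact p.2.trans p.1.2.2.1, fun f => ⟨_, hasL2Deriv_concatPath p f⟩⟩

lemma concat_apply_of_le (p : Composable d M) (t s : I) (ht : (t : ℝ) ≤ 1 / 2)
    (hs : (s : ℝ) = 2 * t) : (concat p).1 t = p.1.1.1 s := by
  change concatPath p t = _
  simp only [concatPath, Path.trans_apply, dif_pos ht]
  exact congrArg p.1.1.1 (Subtype.ext hs.symm)

lemma concat_apply_of_ge (p : Composable d M) (t s : I) (ht : 1 / 2 ≤ (t : ℝ))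
    (hs : (s : ℝ) = 2 * t - 1) : (concat p).1 t = p.1.2.1 s := by
  rcases ht.lt_or_eq with h | h
  · change concatPath p t = _
    simp only [concatPath, Path.trans_apply, dif_neg (not_le.2 h)]
    exact congrArg p.1.2.1 (Subtype.ext hs.symm)
  · have h1 : s = 0 := Subtype.ext (by rw [hs, ← h]; norm_num)
    rw [concat_apply_of_le p t 1 h.ge (by rw [← h]; norm_num), h1]
    exact p.1.1.2.1.symm.trans p.2

lemma continuous_concat : Continuous (concat : Composable d M → LoopSpace d M) := by
  have c1 : Continuous fun p : Composable d M => p.1.1.1 :=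
    LoopSpace.continuous_val.comp (continuous_fst.comp continuous_subtype_val)
  have c2 : Continuous fun p : Composable d M => p.1.2.1 :=
    LoopSpace.continuous_val.comp (continuous_snd.comp continuous_subtype_val)
  rw [LoopSpace.continuous_iff]
  constructor
  · refine ContinuousMap.continuous_of_continuous_uncurry _ ?_
    exact Path.trans_continuous_family (fun p : Composable d M => pathOf p.1.1)
      (continuous_eval.comp ((c1.comp continuous_fst).prodMk continuous_snd)) pathOf'
      (continuous_eval.comp ((c2.comp continuous_fst).prodMk continuous_snd))
  · intro f
    have : (fun p : Composable d M => (concat p).derivL2 f) = fun p =>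
        (2 : ℝ) • (firstHalf (p.1.1.derivL2 f) + secondHalf (p.1.2.derivL2 f)) :=
      funext fun p => LoopSpace.derivL2_eq (hasL2Deriv_concatPath p f)
    rw [this]
    have d1 : Continuous fun p : Composable d M => p.1.1.derivL2 f :=
      (LoopSpace.continuous_derivL2 f).comp (continuous_fst.comp continuous_subtype_val)
    have d2 : Continuous fun p : Composable d M => p.1.2.derivL2 f :=
      (LoopSpace.continuous_derivL2 f).comp (continuous_snd.comp continuous_subtype_val)
    exact ((firstHalf.continuous.comp d1).add (secondHalf.continuous.comp d2)).const_smul (2 : ℝ)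

/-- `t ↦ t / 2`. -/
def lowerHalf : C(I, I) :=
  ⟨fun t => ⟨t / 2, by linarith [t.2.1], by linarith [t.2.2]⟩, by fun_prop⟩

/-- `t ↦ 1 / 2 + t / 2`. -/
def upperHalf : C(I, I) :=
  ⟨fun t => ⟨1 / 2 + t / 2, by linarith [t.2.1], by linarith [t.2.2]⟩, by fun_prop⟩

lemma hasL2Deriv_lower (η : LoopSpace d M) (f : C^∞⟮𝓡 d, M; 𝓘(ℝ, ℝ), ℝ⟯) :
    HasL2Deriv (f ∘ (η.1.comp lowerHalf)) ((2⁻¹ : ℝ) • stretchFirst (η.derivL2 f)) :=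
  hasL2Deriv_stretchFirst (η.hasL2Deriv f) fun t s hs => by
    simp only [Function.comp_apply, ContinuousMap.comp_apply]
    congr 2
    exact Subtype.ext hs.symm

lemma hasL2Deriv_upper (η : LoopSpace d M) (f : C^∞⟮𝓡 d, M; 𝓘(ℝ, ℝ), ℝ⟯) :
    HasL2Deriv (f ∘ (η.1.comp upperHalf)) ((2⁻¹ : ℝ) • stretchSecond (η.derivL2 f)) :=
  hasL2Deriv_stretchSecond (η.hasL2Deriv f) fun t s hs => by
    simp only [Function.comp_apply, ContinuousMap.comp_apply]
    congr 2
    exact Subtype.ext hs.symm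

lemma lowerHalf_zero : lowerHalf 0 = 0 := Subtype.ext (by simp [lowerHalf])
lemma lowerHalf_one : lowerHalf 1 = half := Subtype.ext (by simp [lowerHalf, half])
lemma upperHalf_zero : upperHalf 0 = half := Subtype.ext (by simp [upperHalf, half])
lemma upperHalf_one : upperHalf 1 = 1 := Subtype.ext (by simp [upperHalf]; norm_num)

/-- The first half `t ↦ η(t/2)` of a loop in `L_{1/2} M`. -/
def firstLoop (η : HalfLoops d M) : LoopSpace d M :=
  ⟨η.1.1.comp lowerHalf, by
    rw [ContinuousMap.comp_apply, ContinuousMap.comp_apply, lowerHalf_zero, lowerHalf_one]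
    exact η.2.symm, fun f => ⟨_, hasL2Deriv_lower η.1 f⟩⟩

/-- The second half `t ↦ η(1/2 + t/2)` of a loop in `L_{1/2} M`. -/
def secondLoop (η : HalfLoops d M) : LoopSpace d M :=
  ⟨η.1.1.comp upperHalf, by
    rw [ContinuousMap.comp_apply, ContinuousMap.comp_apply, upperHalf_zero, upperHalf_one]
    exact Eq.trans η.2 η.1.2.1, fun f => ⟨_, hasL2Deriv_upper η.1 f⟩⟩

lemma continuous_firstLoop : Continuous (firstLoop : HalfLoops d M → LoopSpace d M) := by
  rw [LoopSpace.continuous_iff]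
  refine ⟨(ContinuousMap.continuous_precomp _).comp
    (LoopSpace.continuous_val.comp continuous_subtype_val), fun f => ?_⟩
  have : (fun η : HalfLoops d M => (firstLoop η).derivL2 f) = fun η =>
      (2⁻¹ : ℝ) • stretchFirst (η.1.derivL2 f) :=
    funext fun η => LoopSpace.derivL2_eq (hasL2Deriv_lower η.1 f)
  rw [this]
  exact (stretchFirst.continuous.comp
    ((LoopSpace.continuous_derivL2 f).comp continuous_subtype_val)).const_smul (2⁻¹ : ℝ)

lemma continuous_secondLoop : Continuous (secondLoop : HalfLoops d M → LoopSpace d M) := by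
  rw [LoopSpace.continuous_iff]
  refine ⟨(ContinuousMap.continuous_precomp _).comp
    (LoopSpace.continuous_val.comp continuous_subtype_val), fun f => ?_⟩
  have : (fun η : HalfLoops d M => (secondLoop η).derivL2 f) = fun η =>
      (2⁻¹ : ℝ) • stretchSecond (η.1.derivL2 f) :=
    funext fun η => LoopSpace.derivL2_eq (hasL2Deriv_upper η.1 f)
  rw [this]
  exact (stretchSecond.continuous.comp
    ((LoopSpace.continuous_derivL2 f).comp continuous_subtype_val)).const_smul (2⁻¹ : ℝ)

/-- `α * β` as an element of `L_{1/2} M`. -/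
def concatHalf (p : Composable d M) : HalfLoops d M :=
  ⟨concat p, by
    change (concat p).1 half = (concat p).1 0
    rw [concat_apply_of_le p half 1 (by simp [half]) (by simp [half]),
      concat_apply_of_le p 0 0 (by simp) (by simp)]
    exact p.1.1.2.1.symm⟩

/-- Cutting a loop of `L_{1/2} M` in its two halves. -/
def cut (η : HalfLoops d M) : Composable d M :=
  ⟨(firstLoop η, secondLoop η), by
    change η.1.1 (lowerHalf 0) = η.1.1 (upperHalf 0)
    rw [lowerHalf_zero, upperHalf_zero]
    exact Eq.symm η.2⟩

lemma cut_concatHalf (p : Composable d M) : cut (concatHalf p) = p := by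
  refine Subtype.ext (Prod.ext (Subtype.ext (ContinuousMap.ext fun t => ?_))
    (Subtype.ext (ContinuousMap.ext fun t => ?_)))
  · exact concat_apply_of_le p (lowerHalf t) t
      (by have := t.2.2; simp only [lowerHalf, ContinuousMap.coe_mk]; linarith)
      (by simp only [lowerHalf, ContinuousMap.coe_mk]; ring)
  · exact concat_apply_of_ge p (upperHalf t) t
      (by have := t.2.1; simp only [upperHalf, ContinuousMap.coe_mk]; linarith)
      (by simp only [upperHalf, ContinuousMap.coe_mk]; ring)

lemma concatHalf_cut (η : HalfLoops d M) : concatHalf (cut η) = η := by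
  refine Subtype.ext (Subtype.ext (ContinuousMap.ext fun t => ?_))
  rcases le_total (t : ℝ) (1 / 2) with ht | ht
  · have hs : 2 * (t : ℝ) ∈ I := ⟨by linarith [t.2.1], by linarith⟩
    refine (concat_apply_of_le _ t ⟨2 * t, hs⟩ ht rfl).trans ?_
    change η.1.1 (lowerHalf _) = _
    congr 1
    exact Subtype.ext (by simp [lowerHalf])
  · have hs : 2 * (t : ℝ) - 1 ∈ I := ⟨by linarith, by linarith [t.2.2]⟩
    refine (concat_apply_of_ge _ t ⟨2 * t - 1, hs⟩ ht rfl).trans ?_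
    change η.1.1 (upperHalf _) = _
    congr 1
    exact Subtype.ext (by simp only [upperHalf, ContinuousMap.coe_mk]; ring)

variable (d M)

/-- The homeomorphism `γ : LM ×_M LM → L_{1/2} M`, `(α, β) ↦ α * β`. -/
def concatHomeo : Composable d M ≃ₜ HalfLoops d M where
  toFun := concatHalf
  invFun := cut
  left_inv := cut_concatHalf
  right_inv := concatHalf_cut
  continuous_toFun := continuous_concat.subtype_mk _
  continuous_invFun := (continuous_firstLoop.prodMk continuous_secondLoop).subtype_mk _

end Loops

/-! ### Umkehr maps -/

section Umkehr

/-- A map of pairs `(X, A) → (Y, B)`, from a continuous map `f : X → Y` with `f(A) ⊆ B`. -/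
def pairMap {X Y : Type w} [TopologicalSpace X] [TopologicalSpace Y] (f : C(X, Y)) {A : Set X}
    {B : Set Y} (h : Set.MapsTo f A B) :
    (TopPair.ofSubset (X := TopCat.of X) A) ⟶ (TopPair.ofSubset (X := TopCat.of Y) B) :=
  TopPair.ofHom (X := TopPair.ofSubset (X := TopCat.of X) A)
    (Y := TopPair.ofSubset (X := TopCat.of Y) B) (TopCat.ofHom f)
    (TopCat.ofHom ⟨h.restrict, f.continuous.restrict h⟩) rfl

/-- A tubular neighbourhood of an embedding `e : X → Y` of codimension `d`: a vector bundle of rank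
`d` over `X` (the normal bundle) and a homeomorphism `exp` of its total space onto an open subset of
`Y` which is `e` on the zero section. -/
structure TubularNeighbourhood (d : ℕ) {X Y : Type w} [TopologicalSpace X] [TopologicalSpace Y]
    (e : C(X, Y)) where
  /-- The fibres of the normal bundle. -/
  normal : X → Type w
  [addCommGroup : ∀ x, AddCommGroup (normal x)]
  [module : ∀ x, Module ℝ (normal x)]
  [topFibre : ∀ x, TopologicalSpace (normal x)]
  [topTotal : TopologicalSpace (Bundle.TotalSpace (EuclideanSpace ℝ (Fin d)) normal)]
  [fiberBundle : FiberBundle (EuclideanSpace ℝ (Fin d)) normal]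
  [vectorBundle : VectorBundle ℝ (EuclideanSpace ℝ (Fin d)) normal]
  /-- The exponential map from the total space of the normal bundle. -/
  exp : Bundle.TotalSpace (EuclideanSpace ℝ (Fin d)) normal → Y
  isOpenEmbedding_exp : Topology.IsOpenEmbedding exp
  exp_zero : ∀ x, exp ⟨x, 0⟩ = e x

namespace TubularNeighbourhood

attribute [instance] addCommGroup module topFibre topTotal fiberBundle vectorBundle

variable {d : ℕ} {X Y : Type w} [TopologicalSpace X] [TopologicalSpace Y] {e : C(X, Y)}
  (N : TubularNeighbourhood d e)

/-- The total space of the normal bundle. -/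
abbrev Total : Type w := Bundle.TotalSpace (EuclideanSpace ℝ (Fin d)) N.normal

/-- The complement of the zero section. -/
def nonzero : Set N.Total := {v | v.2 ≠ 0}

/-- The map `exp`, from the normal bundle to `Y`. -/
def expMap : C(N.Total, Y) := ⟨N.exp, N.isOpenEmbedding_exp.continuous⟩

/-- The projection of the normal bundle. -/
def projMap : C(N.Total, X) :=
  ⟨Bundle.TotalSpace.proj, FiberBundle.continuous_proj (EuclideanSpace ℝ (Fin d)) N.normal⟩

lemma mapsTo_expMap {Z : Set Y} (hZ : Set.range e = Z) : Set.MapsTo N.expMap N.nonzero Zᶜ := by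
  rintro v hv hvZ
  rw [← hZ] at hvZ
  obtain ⟨x, hx⟩ := hvZ
  have h1 : (⟨x, 0⟩ : N.Total) = v :=
    N.isOpenEmbedding_exp.injective ((N.exp_zero x).trans hx)
  subst h1
  exact hv rfl

/-- The map of pairs `(ν, ν ∖ 0) → (Y, Y ∖ Z)` given by `exp`, where `Z = e(X)`. -/
def expPair {Z : Set Y} (hZ : Set.range e = Z) :
    (TopPair.ofSubset (X := TopCat.of N.Total) N.nonzero) ⟶
      (TopPair.ofSubset (X := TopCat.of Y) Zᶜ) :=
  pairMap N.expMap (N.mapsTo_expMap hZ)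

variable {C : Type u} [Category.{v} C] [Abelian C] [HasCoproducts.{w} C] (R : C)

/-- The map `H_n(ν, ν ∖ 0) → H_n(Y, Y ∖ e(X))` induced by `exp`. It is an isomorphism by excision
when `e(X)` is closed. -/
def excision {Z : Set Y} (hZ : Set.range e = Z) (n : ℕ) :
    (relHomology R n).obj (TopPair.ofSubset (X := TopCat.of N.Total) N.nonzero) ⟶
      (relHomology R n).obj (TopPair.ofSubset (X := TopCat.of Y) Zᶜ) :=
  (relHomology R n).map (N.expPair hZ)

end TubularNeighbourhood

open Classical in
/-- The inverse of an isomorphism (and `0` for a map which is not invertible). -/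
def inverseOf {C : Type u} [Category.{v} C] [Preadditive C] {A B : C} (f : A ⟶ B) : B ⟶ A :=
  if h : IsIso f then inv f else 0

variable {C : Type u} [Category.{v} C] [Abelian C] [HasCoproducts.{w} C] (R : C)
  {d : ℕ} {X Y : Type w} [TopologicalSpace X] [TopologicalSpace Y]

/-- The umkehr map `e_!` of an embedding `e : X → Y` of codimension `d` with image `Z` and Thom class
`τ ∈ H^d(Y, Y ∖ Z)`, computed in a tubular neighbourhood with normal bundle `π : ν → X`:
`H_{d+n}(Y) → H_{d+n}(Y, Y ∖ Z) ≅ H_{d+n}(ν, ν ∖ 0) → H_n(ν) → H_n(X)`, where the isomorphism is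
excision followed by `exp`, the next map is the cap product with the Thom class (restricted to `ν`),
and the last one is `π_*`. -/
def umkehr {e : C(X, Y)} (N : TubularNeighbourhood d e) {Z : Set Y} (hZ : Set.range e = Z)
    (τ : relCohomology d (TopPair.ofSubset (X := TopCat.of Y) Zᶜ)) (n : ℕ) :
    ((singularHomologyFunctor C (d + n)).obj R).obj (TopCat.of Y) ⟶
      ((singularHomologyFunctor C n).obj R).obj (TopCat.of X) :=
  toRelHomology R (d + n) (TopPair.ofSubset (X := TopCat.of Y) Zᶜ) ≫
    inverseOf (N.excision R hZ (d + n)) ≫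
    cap R d n _ (cohomologyMap d (N.expPair hZ) τ) ≫
    ((singularHomologyFunctor C n).obj R).map (TopCat.ofHom N.projMap)

end Umkehr

/-! ### Orientations and Thom classes -/

section Orientation

/-- The coefficient module of homology with coefficients in a ring `k`. -/
abbrev coeff (k : Type v) [Ring k] : ModuleCat.{max w v} k := ModuleCat.of k (ULift.{w} k)

/-- The class of a point `x` in `H_0(X; ℤ)`. -/
def pointClass {X : Type w} [TopologicalSpace X] (x : X) :
    ((singularHomologyFunctor (ModuleCat.{w} ℤ) 0).obj (coeff.{w} ℤ)).obj (TopCat.of X) :=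
  ((((TopCat.toSSet.obj (TopCat.of X)).chainComplex (coeff.{w} ℤ)).liftCycles
    ((TopCat.toSSet.obj (TopCat.of X)).ιChainComplex
      (((TopCat.of X).toSSetObjEquiv (Opposite.op ⦋0⦌)).symm (ContinuousMap.const _ x)))
    _ rfl (by rw [HomologicalComplex.shape _ _ _ (by simp), comp_zero]) ≫
    ((TopCat.toSSet.obj (TopCat.of X)).chainComplex (coeff.{w} ℤ)).homologyπ 0).hom
    (ULift.up (1 : ℤ)) :)

variable (d : ℕ) (M : Type w) [TopologicalSpace M]

/-- The pair `(M, M ∖ U)`. -/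
abbrev localPair (U : Set M) : TopPair.{w} := TopPair.ofSubset (X := TopCat.of M) Uᶜ

/-- `H_d(M, M ∖ U; ℤ)`. -/
abbrev localHomology (U : Set M) : Type w :=
  (relHomology (coeff.{w} ℤ) d).obj (localPair M U)

/-- For `V ⊆ U`, the inclusion `(M, M ∖ U) → (M, M ∖ V)`. -/
def restrictLocal {U V : Set M} (h : V ⊆ U) : localPair M U ⟶ localPair M V :=
  pairMap (ContinuousMap.id M) (fun _ hx hxV => hx (h hxV))

/-- An orientation of a `d`-manifold `M`: a generator of the local homology group
`H_d(M, M ∖ {x}; ℤ)` at each point `x`, which is locally induced by a class in `H_d(M, M ∖ U; ℤ)`. -/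
structure HomologyOrientation where
  localClass : ∀ x : M, localHomology d M {x}
  generates : ∀ x, Submodule.span ℤ {localClass x} = ⊤
  locally_consistent : ∀ x, ∃ U : Set M, IsOpen U ∧ x ∈ U ∧ ∃ c : localHomology d M U,
    ∀ y (hy : y ∈ U), (relHomology (coeff.{w} ℤ) d).map
      (restrictLocal M (Set.singleton_subset_iff.2 hy)) c = localClass y

/-- The pair `(M × M, M × M ∖ Δ)`, where `Δ` is the diagonal. -/
abbrev diagonalPair : TopPair.{w} :=
  TopPair.ofSubset (X := TopCat.of (M × M)) (Set.diagonal M)ᶜ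

variable {d M}

/-- The map of pairs `y ↦ (x, y)` from `(M, M ∖ {x})` to `(M × M, M × M ∖ Δ)`. -/
def slice (x : M) : localPair M {x} ⟶ diagonalPair M :=
  pairMap ((ContinuousMap.const M x).prodMk (ContinuousMap.id M)) (fun _ hy h => hy (Eq.symm h))

/-- `τ` is the Thom class of the diagonal embedding `M → M × M` of the oriented manifold `M`: its
restriction to each normal slice `(M, M ∖ {x})` takes the value `1` on the orientation class at
`x`. -/
def IsThomClass (o : HomologyOrientation d M) (τ : relCohomology d (diagonalPair M)) : Prop :=
  ∀ x, cap (coeff.{w} ℤ) d 0 (localPair M {x}) (cohomologyMap d (slice x) τ) (o.localClass x) =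
    pointClass x

end Orientation

/-! ### The loop coproduct -/

section Coproduct

variable (d : ℕ) (M : Type w) [TopologicalSpace M] [ChartedSpace (EuclideanSpace ℝ (Fin d)) M]

/-- The map `δ_in : LM ×_M LM → LM`, `(α, β) ↦ α * β`. -/
def deltaIn : C(Composable d M, LoopSpace d M) := ⟨concat, continuous_concat⟩

/-- The map `δ_out : LM ×_M LM → LM × LM`, `(α, β) ↦ (α, β)`. -/
def deltaOut : C(Composable d M, LoopSpace d M × LoopSpace d M) :=
  ⟨fun p => (p.1.1, p.1.2), continuous_subtype_val⟩

lemma range_inclHalf : Set.range (inclHalf d M) = halfSet d M := Subtype.range_val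

lemma range_deltaIn : Set.range (deltaIn d M) = halfSet d M := by
  rw [← range_inclHalf]
  exact (concatHomeo d M).surjective.range_comp (inclHalf d M)

lemma mapsTo_evPair : Set.MapsTo (evPair d M) (halfSet d M)ᶜ (Set.diagonal M)ᶜ :=
  fun _ hη h => hη (Eq.symm h)

variable {d M}

/-- The Thom class in `H^d(LM, LM ∖ L_{1/2} M; ℤ)`: the pull-back along `ev(0) × ev(1/2)` of the Thom
class of the diagonal of `M`. -/
def loopThomClass (τ : relCohomology d (diagonalPair M)) :
    relCohomology d (TopPair.ofSubset (X := TopCat.of (LoopSpace d M)) (halfSet d M)ᶜ) :=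
  cohomologyMap d (pairMap (evPair d M) (mapsTo_evPair d M)) τ

variable (k : Type v) [Ring k]

/-- The homology group `H_n(X; k)`. -/
abbrev H (n : ℕ) (X : Type w) [TopologicalSpace X] : ModuleCat.{max w v} k :=
  ((singularHomologyFunctor (ModuleCat.{max w v} k) n).obj (coeff.{w} k)).obj (TopCat.of X)

/-- The map `f_* : H_n(X; k) → H_n(Y; k)`. -/
abbrev pushforward (n : ℕ) {X Y : Type w} [TopologicalSpace X] [TopologicalSpace Y] (f : C(X, Y)) :
    H k n X ⟶ H k n Y :=
  ((singularHomologyFunctor (ModuleCat.{max w v} k) n).obj (coeff.{w} k)).map (TopCat.ofHom f)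

/-- The isomorphism `f_* : H_n(X; k) ≅ H_n(Y; k)` induced by a homeomorphism. -/
abbrev pushforwardIso (n : ℕ) {X Y : Type w} [TopologicalSpace X] [TopologicalSpace Y]
    (f : X ≃ₜ Y) : H k n X ≅ H k n Y :=
  ((singularHomologyFunctor (ModuleCat.{max w v} k) n).obj (coeff.{w} k)).mapIso
    (TopCat.isoOfHomeo (X := TopCat.of X) (Y := TopCat.of Y) f)

/-- The umkehr map `(δ_in)_! : H_{d+n}(LM) → H_n(LM ×_M LM)`. -/
def deltaInUmkehr (τ : relCohomology d (diagonalPair M))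
    (N : TubularNeighbourhood d (deltaIn d M)) (n : ℕ) :
    H k (d + n) (LoopSpace d M) ⟶ H k n (Composable d M) :=
  umkehr (coeff.{w} k) N (range_deltaIn d M) (loopThomClass τ) n

/-- The loop coproduct `Φ = (δ_out)_* ∘ (δ_in)_! : H_{d+n}(LM) → H_n(LM × LM)`. -/
def loopCoproduct (τ : relCohomology d (diagonalPair M))
    (N : TubularNeighbourhood d (deltaIn d M)) (n : ℕ) :
    H k (d + n) (LoopSpace d M) ⟶ H k n (LoopSpace d M × LoopSpace d M) :=
  deltaInUmkehr k τ N n ≫ pushforward k n (deltaOut d M)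

/-- The umkehr map `j̃_! : H_{d+n}(LM) → H_n(L_{1/2} M)`. -/
def inclHalfUmkehr (τ : relCohomology d (diagonalPair M))
    (N : TubularNeighbourhood d (inclHalf d M)) (n : ℕ) :
    H k (d + n) (LoopSpace d M) ⟶ H k n (HalfLoops d M) :=
  umkehr (coeff.{w} k) N (range_inclHalf d M) (loopThomClass τ) n

/-- The map `comp_! = γ_*⁻¹ ∘ j̃_! : H_{d+n}(LM) → H_n(LM ×_M LM)`. -/
def compUmkehr (τ : relCohomology d (diagonalPair M))
    (N : TubularNeighbourhood d (inclHalf d M)) (n : ℕ) :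
    H k (d + n) (LoopSpace d M) ⟶ H k n (Composable d M) :=
  inclHalfUmkehr k τ N n ≫ (pushforwardIso k n (concatHomeo d M)).inv

end Coproduct

end StringTopology

end

noncomputable section

namespace StringTopology

/-! ### Chains of tuples of points, and their barycentric subdivision -/

/-! Both δ_in and j̃ have image Z = `halfSet`, which is closed because M is Hausdorff, and δ_in = j̃
∘ γ. The theorem is thus an instance of a general fact, `umkehr_comp_map`: if e : X → Y and e' : X'
→ Y have the same closed image Z, if e' ∘ g = e, and if both umkehr maps use the same class τ in
H^d(Y, Y ∖ Z), then g_* ∘ e_! = e'_!, whatever the tubular neighbourhoods. Taking g = γ and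
inverting γ_* gives (δ_in)_! = comp_!, and the formula for Φ follows because δ_out and Δ̃ are the
same map.

The general fact needs no uniqueness theorem for tubular neighbourhoods. Let W ⊆ ν consist of the v
such that exp(tv) stays in exp'(ν') for all t in [0, 1]. It is an open neighbourhood of the zero
section and embeds over Y in both normal bundles, by the inclusion p and by p' = exp'⁻¹ ∘ exp.
Excision identifies the relative homology of (W, W ∖ 0) with that of (ν, ν ∖ 0), (ν', ν' ∖ 0) and
(Y, Y ∖ Z), and naturality of the cap product (`relHomology_map_cap`) turns both cap products into
the cap product on W with one and the same pull-back of τ. What remains is to compare g ∘ π ∘ p with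
π' ∘ p'; they are homotopic through π'(exp'⁻¹(exp(tv))), whose value at t = 0 is g(x) for v over x,
since exp of the zero vector at x is e(x) = e'(g(x)).

Excision (`isIso_relHomology_map_pairMap`) rests on barycentric subdivision. The subdivision S and a
homotopy T between S and the identity are built by coning on chains of tuples of points, where their
identities are formal, and then carried to singular chains along affine simplices. Metrically, S
shrinks affine m-simplices by the factor m/(m+1), so a Lebesgue number makes some iterate of S turn
any given chain into a small one (`exists_iterate_subdiv_mem`). Bijectivity on relative homology is
then checked on elements (`isIso_homologyMap_cokernelMap`), without forming the complex of small
chains. -/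

/-- The simplicial set whose `n`-simplices are the `(n + 1)`-tuples of elements of `K`. -/
def tuples (K : Type w) : SSet.{w} where
  obj n := Fin (n.unop.len + 1) → K
  map f := ↾fun v => v ∘ f.unop.toOrderHom

/-- The map of simplicial sets of tuples induced by a map of sets. -/
def tuplesMap {K K' : Type w} (g : K → K') : tuples K ⟶ tuples K' where
  app _ := ↾fun v => g ∘ v

/-- The join of a point and a tuple. -/
def coneTuple {K : Type w} (b : K) {n : ℕ} (v : (tuples K) _⦋n⦌) : (tuples K) _⦋n + 1⦌ :=
  (Fin.cons b v : Fin (n + 2) → K)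

lemma δ_coneTuple_zero {K : Type w} (b : K) {n : ℕ} (v : (tuples K) _⦋n⦌) :
    (tuples K).δ 0 (coneTuple b v) = v := by
  funext j
  exact Fin.cons_succ (α := fun _ => K) b v j

lemma δ_coneTuple_succ {K : Type w} (b : K) {n : ℕ} (v : (tuples K) _⦋n + 1⦌) (i : Fin (n + 2)) :
    (tuples K).δ i.succ (coneTuple b v) = coneTuple b ((tuples K).δ i v) := by
  funext j
  change (Fin.cons b v : Fin (n + 3) → K) (i.succ.succAbove j) =
    (Fin.cons b (fun l => v (i.succAbove l)) : Fin (n + 2) → K) j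
  cases j using Fin.cases with
  | zero => rw [Fin.succ_succAbove_zero]; rfl
  | succ j => rw [Fin.succ_succAbove_succ]; rfl

lemma δ_coneTuple_last {K : Type w} (b : K) (v : (tuples K) _⦋0⦌) :
    (tuples K).δ 1 (coneTuple b v) = ((fun _ => b : Fin 1 → K) : (tuples K) _⦋0⦌) := by
  funext j
  obtain rfl := Subsingleton.elim (α := Fin 1) j 0
  rfl

/-! ### Cones, subdivision and its homotopy on chains of tuples. -/

section Chains

variable {C : Type u} [Category.{v} C] [Preadditive C] [HasCoproducts.{w} C] {R : C}

/-- The map on chains with given values on simplices. -/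
def descChain {X : SSet.{w}} {n : ℕ} {T : C} (f : X _⦋n⦌ → (R ⟶ T)) :
    (X.chainComplex R).X n ⟶ T :=
  Sigma.desc f

@[simp]
lemma ι_descChain {X : SSet.{w}} {n : ℕ} {T : C} (f : X _⦋n⦌ → (R ⟶ T)) (s : X _⦋n⦌) :
    X.ιChainComplex s ≫ descChain f = f s :=
  Sigma.ι_desc _ _

@[simp]
lemma ι_descChain_assoc {X : SSet.{w}} {n : ℕ} {T T' : C} (f : X _⦋n⦌ → (R ⟶ T)) (s : X _⦋n⦌)
    (g : T ⟶ T') : X.ιChainComplex s ≫ descChain f ≫ g = f s ≫ g := by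
  rw [← Category.assoc, ι_descChain]

variable (R) {K : Type w}

/-- The cone operator with vertex `b`. -/
def coneChain (b : K) (n : ℕ) :
    ((tuples K).chainComplex R).X n ⟶ ((tuples K).chainComplex R).X (n + 1) :=
  descChain fun v => (tuples K).ιChainComplex (coneTuple b v)

@[simp]
lemma ι_coneChain (b : K) (n : ℕ) (v : (tuples K) _⦋n⦌) :
    (tuples K).ιChainComplex v ≫ coneChain R b n = (tuples K).ιChainComplex (coneTuple b v) :=
  ι_descChain _ _

@[simp]
lemma ι_coneChain_assoc (b : K) (n : ℕ) (v : (tuples K) _⦋n⦌) {T : C}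
    (g : ((tuples K).chainComplex R).X (n + 1) ⟶ T) :
    (tuples K).ιChainComplex v ≫ coneChain R b n ≫ g =
      (tuples K).ιChainComplex (coneTuple b v) ≫ g :=
  ι_descChain_assoc _ _ _

/-- Face 0 of a cone deletes the vertex; every other face is the cone on a face, with the sign
shifted by one. So coning is a contracting homotopy in positive degrees. -/
lemma coneChain_d_succ (b : K) (n : ℕ) :
    coneChain R b (n + 1) ≫ ((tuples K).chainComplex R).d (n + 2) (n + 1) =
      𝟙 _ - ((tuples K).chainComplex R).d (n + 1) n ≫ coneChain R b n := by
  ext v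
  simp only [ι_coneChain_assoc, SSet.ιChainComplex_d, Preadditive.comp_sub, Category.comp_id,
    SSet.ιChainComplex_d_assoc, Preadditive.sum_comp, Preadditive.zsmul_comp, ι_coneChain]
  rw [Fin.sum_univ_succ, δ_coneTuple_zero, sub_eq_add_neg, ← Finset.sum_neg_distrib]
  congr 1
  · simp
  · refine Finset.sum_congr rfl fun i _ => ?_
    rw [δ_coneTuple_succ, Fin.val_succ, pow_succ, mul_neg_one, neg_smul]

/-- In degree 0 the boundary of the cone on v is v - b instead of v. The correction only sees the
augmentation of a 0-chain, which vanishes on boundaries; this is all that the recursions below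
require. -/
lemma d_coneChain_zero_d (b : K) :
    ((tuples K).chainComplex R).d 1 0 ≫ coneChain R b 0 ≫ ((tuples K).chainComplex R).d 1 0 =
      ((tuples K).chainComplex R).d 1 0 := by
  ext v
  simp [Fin.sum_univ_two, Preadditive.add_comp, δ_coneTuple_last,
    δ_coneTuple_zero, Preadditive.neg_comp]

lemma coneChain_map {K' : Type w} (g : K → K') (b : K) (n : ℕ) :
    coneChain R b n ≫ (SSet.chainComplexMap (tuplesMap g) R).f (n + 1) =
      (SSet.chainComplexMap (tuplesMap g) R).f n ≫ coneChain R (g b) n := by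
  ext v
  rw [ι_coneChain_assoc, SSet.ι_chainComplexMap_f, SSet.ι_chainComplexMap_f_assoc, ι_coneChain]
  congr 1
  funext j
  change g ((Fin.cons b v : Fin (n + 2) → K) j) = (Fin.cons (g b) (g ∘ v) : Fin (n + 2) → K') j
  cases j using Fin.cases <;> rfl

variable (β : ∀ n : ℕ, (tuples K) _⦋n⦌ → K)

/-- The subdivision operator on chains of tuples, for a choice `β` of a centre of each tuple. -/
def subdivTuples (n : ℕ) : ((tuples K).chainComplex R).X n ⟶ ((tuples K).chainComplex R).X n :=
  Nat.rec (motive := fun n => ((tuples K).chainComplex R).X n ⟶ ((tuples K).chainComplex R).X n)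
    (𝟙 _) (fun n S => descChain fun v => (tuples K).ιChainComplex v ≫
      ((tuples K).chainComplex R).d (n + 1) n ≫ S ≫ coneChain R (β _ v) n) n

lemma subdivTuples_zero : subdivTuples R β 0 = 𝟙 _ := rfl

lemma ι_subdivTuples_succ (n : ℕ) (v : (tuples K) _⦋n + 1⦌) :
    (tuples K).ιChainComplex v ≫ subdivTuples R β (n + 1) = (tuples K).ιChainComplex v ≫
      ((tuples K).chainComplex R).d (n + 1) n ≫ subdivTuples R β n ≫ coneChain R (β _ v) n :=
  ι_descChain _ _

/-- By definition S v = b·S∂v, with b the centre of v. Hence ∂S v = S∂v - b·∂S∂v, and inductively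
∂S∂v = S∂∂v = 0. -/
lemma subdivTuples_d (n : ℕ) :
    subdivTuples R β (n + 1) ≫ ((tuples K).chainComplex R).d (n + 1) n =
      ((tuples K).chainComplex R).d (n + 1) n ≫ subdivTuples R β n := by
  induction n with
  | zero =>
    apply SSet.chainComplex_hom_ext
    intro v
    rw [← Category.assoc, ι_subdivTuples_succ]
    simp only [subdivTuples_zero, Category.id_comp, Category.assoc, Category.comp_id]
    rw [d_coneChain_zero_d]
  | succ n ih =>
    apply SSet.chainComplex_hom_ext
    intro v
    rw [← Category.assoc, ι_subdivTuples_succ]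
    simp only [Category.assoc]
    rw [coneChain_d_succ, Preadditive.comp_sub, Category.comp_id, reassoc_of% ih,
      Preadditive.comp_sub, HomologicalComplex.d_comp_d_assoc]
    simp

/-- The homotopy between the identity and the subdivision operator on chains of tuples. -/
def subdivTuplesHomotopy (n : ℕ) :
    ((tuples K).chainComplex R).X n ⟶ ((tuples K).chainComplex R).X (n + 1) :=
  Nat.rec
    (motive := fun n => ((tuples K).chainComplex R).X n ⟶ ((tuples K).chainComplex R).X (n + 1))
    0 (fun n S => descChain fun v => (tuples K).ιChainComplex v ≫
      (𝟙 _ - ((tuples K).chainComplex R).d (n + 1) n ≫ S) ≫ coneChain R (β _ v) (n + 1)) n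

lemma subdivTuplesHomotopy_zero : subdivTuplesHomotopy R β 0 = 0 := rfl

lemma ι_subdivTuplesHomotopy_succ (n : ℕ) (v : (tuples K) _⦋n + 1⦌) :
    (tuples K).ιChainComplex v ≫ subdivTuplesHomotopy R β (n + 1) = (tuples K).ιChainComplex v ≫
      (𝟙 _ - ((tuples K).chainComplex R).d (n + 1) n ≫ subdivTuplesHomotopy R β n) ≫
        coneChain R (β _ v) (n + 1) :=
  ι_descChain _ _

lemma subdivTuplesHomotopy_zero_d :
    subdivTuplesHomotopy R β 0 ≫ ((tuples K).chainComplex R).d 1 0 = 𝟙 _ - subdivTuples R β 0 := by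
  simp [subdivTuplesHomotopy_zero, subdivTuples_zero]

lemma subdivTuplesHomotopy_succ_d (n : ℕ) :
    subdivTuplesHomotopy R β (n + 1) ≫ ((tuples K).chainComplex R).d (n + 2) (n + 1) +
      ((tuples K).chainComplex R).d (n + 1) n ≫ subdivTuplesHomotopy R β n =
      𝟙 _ - subdivTuples R β (n + 1) := by
  -- With T v = b·(v - T∂v), the cone formula leaves b·(∂v - ∂T∂v) to be identified with b·S∂v = S
  -- v. This only uses the homotopy identity one degree lower on boundaries, where its term T∂
  -- disappears.
  have key : ((tuples K).chainComplex R).d (n + 1) n ≫ subdivTuplesHomotopy R β n ≫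
      ((tuples K).chainComplex R).d (n + 1) n =
        ((tuples K).chainComplex R).d (n + 1) n ≫ (𝟙 _ - subdivTuples R β n) := by
    induction n with
    | zero => rw [subdivTuplesHomotopy_zero_d]
    | succ n ih =>
      have h : subdivTuplesHomotopy R β (n + 1) ≫ ((tuples K).chainComplex R).d (n + 2) (n + 1) =
          𝟙 _ - subdivTuples R β (n + 1) -
          ((tuples K).chainComplex R).d (n + 1) n ≫ subdivTuplesHomotopy R β n := by
        apply SSet.chainComplex_hom_ext
        intro v
        rw [← Category.assoc, ι_subdivTuplesHomotopy_succ]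
        simp only [Category.assoc]
        rw [coneChain_d_succ]
        simp only [Preadditive.comp_sub, Preadditive.sub_comp, Category.comp_id, Category.id_comp,
          Category.assoc, ι_subdivTuples_succ]
        rw [reassoc_of% ih]
        simp only [Preadditive.comp_sub, Preadditive.sub_comp, Category.id_comp]
        abel
      rw [h]
      simp only [Preadditive.comp_sub, HomologicalComplex.d_comp_d_assoc, zero_comp, sub_zero]
  rw [← eq_sub_iff_add_eq]
  apply SSet.chainComplex_hom_ext
  intro v
  rw [← Category.assoc, ι_subdivTuplesHomotopy_succ]
  simp only [Category.assoc]
  rw [coneChain_d_succ]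
  simp only [Preadditive.comp_sub, Preadditive.sub_comp, Category.comp_id, Category.id_comp,
    Category.assoc, ι_subdivTuples_succ]
  rw [reassoc_of% key]
  simp only [Preadditive.comp_sub, Preadditive.sub_comp, Category.id_comp]
  abel

/-! ### Compatibility of subdivision with maps that preserve centres. -/

section Naturality

variable {β} {K' : Type w} {β' : ∀ n : ℕ, (tuples K') _⦋n⦌ → K'} {g : K → K'}

/-- Boundaries and cones commute with every map of tuples, so the choice of centres is the only
obstruction. The case in use is that of affine maps, which preserve barycentres. -/
lemma subdivTuples_map (hg : ∀ (n : ℕ) (v : (tuples K) _⦋n⦌), g (β n v) = β' n ((tuplesMap g).app _ v))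
    (n : ℕ) :
    subdivTuples R β n ≫ (SSet.chainComplexMap (tuplesMap g) R).f n =
      (SSet.chainComplexMap (tuplesMap g) R).f n ≫ subdivTuples R β' n := by
  induction n with
  | zero => simp [subdivTuples_zero]
  | succ n ih =>
    apply SSet.chainComplex_hom_ext
    intro v
    rw [← Category.assoc, ι_subdivTuples_succ, SSet.ι_chainComplexMap_f_assoc, ι_subdivTuples_succ,
      ← hg, ← SSet.ι_chainComplexMap_f_assoc]
    simp only [Category.assoc]
    rw [coneChain_map, reassoc_of% ih, HomologicalComplex.Hom.comm_assoc]

lemma subdivTuplesHomotopy_map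
    (hg : ∀ (n : ℕ) (v : (tuples K) _⦋n⦌), g (β n v) = β' n ((tuplesMap g).app _ v)) (n : ℕ) :
    subdivTuplesHomotopy R β n ≫ (SSet.chainComplexMap (tuplesMap g) R).f (n + 1) =
      (SSet.chainComplexMap (tuplesMap g) R).f n ≫ subdivTuplesHomotopy R β' n := by
  induction n with
  | zero => simp [subdivTuplesHomotopy_zero]
  | succ n ih =>
    apply SSet.chainComplex_hom_ext
    intro v
    rw [← Category.assoc, ι_subdivTuplesHomotopy_succ, SSet.ι_chainComplexMap_f_assoc,
      ι_subdivTuplesHomotopy_succ, ← hg, ← SSet.ι_chainComplexMap_f_assoc]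
    simp only [Category.assoc]
    rw [coneChain_map]
    simp only [Preadditive.comp_sub, Preadditive.sub_comp, Category.id_comp, Category.assoc]
    rw [reassoc_of% ih, HomologicalComplex.Hom.comm_assoc]

end Naturality

end Chains

/-! ### Affine simplices in standard simplices -/

/-- The points of the standard `n`-simplex. -/
abbrev SimplexPt (n : ℕ) : Type w := ULift.{w} (stdSimplex ℝ (Fin (n + 1)))

namespace SimplexPt

/-- The convex combination of the points `v i` with weights `t`. -/
def comb {m n : ℕ} (v : Fin (m + 1) → SimplexPt.{w} n) (t : SimplexPt.{w} m) : SimplexPt.{w} n :=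
  ⟨⟨∑ i, t.down.1 i • (v i).down.1, (convex_stdSimplex ℝ _).sum_mem (fun i _ => t.down.2.1 i)
    t.down.2.2 fun i _ => (v i).down.2⟩⟩

lemma comb_val {m n : ℕ} (v : Fin (m + 1) → SimplexPt.{w} n) (t : SimplexPt.{w} m) :
    (comb v t).down.1 = ∑ i, t.down.1 i • (v i).down.1 := rfl

lemma ext_val {n : ℕ} {p q : SimplexPt.{w} n} (h : p.down.1 = q.down.1) : p = q :=
  ULift.ext _ _ (Subtype.ext h)

lemma continuous_comb {m n : ℕ} (v : Fin (m + 1) → SimplexPt.{w} n) : Continuous (comb v) := by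
  refine continuous_uliftUp.comp (Continuous.subtype_mk ?_ _)
  refine continuous_finsetSum _ fun i _ => ?_
  exact ((continuous_apply i).comp (continuous_subtype_val.comp continuous_uliftDown)).smul
    continuous_const

/-- An exchange of sums. It is the source both of the functoriality of affine simplices and of the
fact that affine maps preserve barycentres. -/
lemma comb_comb {l m n : ℕ} (u : Fin (m + 1) → SimplexPt.{w} n) (v : Fin (l + 1) → SimplexPt.{w} m)
    (t : SimplexPt.{w} l) : comb u (comb v t) = comb (comb u ∘ v) t := by
  apply ext_val
  simp only [comb_val, Function.comp_apply, Finset.sum_apply, Pi.smul_apply, Finset.smul_sum,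
    smul_smul, Finset.sum_smul, smul_eq_mul]
  exact Finset.sum_comm

/-- The `i`-th vertex. -/
def vertex (n : ℕ) (i : Fin (n + 1)) : SimplexPt.{w} n := ⟨⟨_, single_mem_stdSimplex ℝ i⟩⟩

lemma comb_vertex {m n : ℕ} (v : Fin (m + 1) → SimplexPt.{w} n) (i : Fin (m + 1)) :
    comb v (vertex m i) = v i := by
  apply ext_val
  simp [comb_val, vertex, Pi.single_apply]

lemma vertex_comb {n : ℕ} (t : SimplexPt.{w} n) : comb (vertex n) t = t := by
  apply ext_val
  rw [comb_val]
  funext j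
  simp [vertex, Pi.single_apply]

/-- Pushing weights forward along `f` adds them up over the fibres of `f`. This makes affine
simplices compatible with all simplicial operators, hence `alongSimplex` a simplicial map. -/
lemma comb_comp {l m n : ℕ} (v : Fin (m + 1) → SimplexPt.{w} n) (f : Fin (l + 1) → Fin (m + 1))
    (t : SimplexPt.{w} l) : comb (v ∘ f) t = comb v ⟨stdSimplex.map f t.down⟩ := by
  apply ext_val
  have h (j) : (stdSimplex.map f t.down).1 j = ∑ i, if f i = j then t.down.1 i else 0 := by
    refine (FunOnFinite.linearMap_apply_apply _ _ _ _ _).trans ?_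
    exact Finset.sum_filter _ _
  simp only [comb_val, h, Finset.sum_smul, Function.comp_apply, ite_smul, zero_smul]
  rw [Finset.sum_comm]
  simp

/-- The barycentre of the standard simplex. -/
def centre (n : ℕ) : SimplexPt.{w} n :=
  ⟨⟨fun _ => ((n : ℝ) + 1)⁻¹, fun _ => by positivity, by
    simp [mul_inv_cancel₀ (Nat.cast_add_one_ne_zero n : (n : ℝ) + 1 ≠ 0)]⟩⟩

/-- The barycentre of a tuple of points. -/
def barycentre {n : ℕ} (m : ℕ) (v : (tuples (SimplexPt.{w} n)) _⦋m⦌) : SimplexPt.{w} n :=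
  comb v (centre m)

end SimplexPt

open SimplexPt

/-- The tuple of vertices of the standard simplex. -/
def vertices (n : ℕ) : (tuples (SimplexPt.{w} n)) _⦋n⦌ := vertex n

/-- The affine map of standard simplices with given values on vertices. -/
def affineMap {m n : ℕ} (v : (tuples (SimplexPt.{w} n)) _⦋m⦌) : SimplexPt.{w} m → SimplexPt.{w} n :=
  comb v

lemma continuous_affineMap {m n : ℕ} (v : (tuples (SimplexPt.{w} n)) _⦋m⦌) :
    Continuous (affineMap v) :=
  continuous_comb _

lemma affineMap_barycentre {m n : ℕ} (u : (tuples (SimplexPt.{w} n)) _⦋m⦌) (l : ℕ)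
    (v : (tuples (SimplexPt.{w} m)) _⦋l⦌) :
    affineMap u (barycentre l v) = barycentre l ((tuplesMap (affineMap u)).app _ v) :=
  comb_comb u v _

lemma tuplesMap_affineMap_vertices {n m : ℕ} (v : (tuples (SimplexPt.{w} n)) _⦋m⦌) :
    (tuplesMap (affineMap v)).app _ (vertices m) = v :=
  funext fun i => comb_vertex v i

variable {X Y : TopCat.{w}}

/-- The continuous map underlying a singular simplex. -/
def simplexMap {n : ℕ} (a : (TopCat.toSSet.obj X) _⦋n⦌) : C(SimplexPt.{w} n, X) :=
  TopCat.Hom.hom (X := SimplexCategory.toTop.{w}.obj ⦋n⦌) a.down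

lemma simplexMap_injective {n : ℕ} :
    Function.Injective (simplexMap : (TopCat.toSSet.obj X) _⦋n⦌ → C(SimplexPt.{w} n, X)) :=
  fun _ _ h => ULift.ext _ _ (TopCat.hom_ext h)

/-- The singular simplex with a given underlying continuous map. -/
def ofSimplexMap {n : ℕ} (f : C(SimplexPt.{w} n, X)) : (TopCat.toSSet.obj X) _⦋n⦌ :=
  ULift.up (TopCat.ofHom (X := SimplexPt.{w} n) f)

/-- A singular simplex induces a map from tuples of points of the standard simplex to singular
simplices. -/
def alongSimplex {n : ℕ} (a : (TopCat.toSSet.obj X) _⦋n⦌) :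
    tuples (SimplexPt.{w} n) ⟶ TopCat.toSSet.obj X where
  app m := ↾fun v => ofSimplexMap (n := m.unop.len)
    ((simplexMap a).comp ⟨affineMap (m := m.unop.len) v, continuous_affineMap _⟩)
  naturality m l f := by
    ext v
    refine simplexMap_injective (n := l.unop.len) (ContinuousMap.ext fun t => ?_)
    exact congrArg (simplexMap a) (comb_comp v f.unop.toOrderHom t)

lemma alongSimplex_vertices {n : ℕ} (a : (TopCat.toSSet.obj X) _⦋n⦌) :
    (alongSimplex a).app _ (vertices n) = a :=
  simplexMap_injective (ContinuousMap.ext fun t => congrArg (simplexMap a) (vertex_comb t))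

lemma alongSimplex_alongSimplex {n m : ℕ} (a : (TopCat.toSSet.obj X) _⦋n⦌)
    (v : (tuples (SimplexPt.{w} n)) _⦋m⦌) :
    alongSimplex ((alongSimplex a).app _ v) = tuplesMap (affineMap v) ≫ alongSimplex a := by
  ext l t
  refine simplexMap_injective (n := l.unop.len) (ContinuousMap.ext fun s => ?_)
  exact congrArg (simplexMap a) (comb_comb v t s)

lemma alongSimplex_map {n : ℕ} (f : X ⟶ Y) (a : (TopCat.toSSet.obj X) _⦋n⦌) :
    alongSimplex ((TopCat.toSSet.map f).app _ a) = alongSimplex a ≫ TopCat.toSSet.map f := rfl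

/-! ### Barycentric subdivision of singular chains -/

section Subdivision

variable {C : Type u} [Category.{v} C] [Preadditive C] [HasCoproducts.{w} C] (R : C)

lemma chainComplexMap_comp_f {A B D : SSet.{w}} (f : A ⟶ B) (g : B ⟶ D) (n : ℕ) :
    (SSet.chainComplexMap (f ≫ g) R).f n =
      (SSet.chainComplexMap f R).f n ≫ (SSet.chainComplexMap g R).f n := by
  apply SSet.chainComplex_hom_ext
  intro s
  rw [SSet.ι_chainComplexMap_f, SSet.ι_chainComplexMap_f_assoc, SSet.ι_chainComplexMap_f]
  rfl

lemma ι_vertices_alongSimplex {n : ℕ} (a : (TopCat.toSSet.obj X) _⦋n⦌) :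
    (tuples (SimplexPt.{w} n)).ιChainComplex (vertices n) ≫
      (SSet.chainComplexMap (alongSimplex a) R).f n =
        (TopCat.toSSet.obj X).ιChainComplex a := by
  rw [SSet.ι_chainComplexMap_f, alongSimplex_vertices]

variable (X) in
/-- Barycentric subdivision of singular chains. -/
def subdiv (n : ℕ) :
    ((TopCat.toSSet.obj X).chainComplex R).X n ⟶ ((TopCat.toSSet.obj X).chainComplex R).X n :=
  descChain fun a => (tuples (SimplexPt.{w} n)).ιChainComplex (vertices n) ≫
    subdivTuples R barycentre n ≫ (SSet.chainComplexMap (alongSimplex a) R).f n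

variable (X) in
/-- The homotopy between the identity and barycentric subdivision. -/
def subdivHomotopy (n : ℕ) :
    ((TopCat.toSSet.obj X).chainComplex R).X n ⟶ ((TopCat.toSSet.obj X).chainComplex R).X (n + 1) :=
  descChain fun a => (tuples (SimplexPt.{w} n)).ιChainComplex (vertices n) ≫
    subdivTuplesHomotopy R barycentre n ≫ (SSet.chainComplexMap (alongSimplex a) R).f (n + 1)

lemma ι_subdiv {n : ℕ} (a : (TopCat.toSSet.obj X) _⦋n⦌) :
    (TopCat.toSSet.obj X).ιChainComplex a ≫ subdiv X R n =
      (tuples (SimplexPt.{w} n)).ιChainComplex (vertices n) ≫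
        subdivTuples R barycentre n ≫ (SSet.chainComplexMap (alongSimplex a) R).f n :=
  ι_descChain _ _

lemma ι_subdivHomotopy {n : ℕ} (a : (TopCat.toSSet.obj X) _⦋n⦌) :
    (TopCat.toSSet.obj X).ιChainComplex a ≫ subdivHomotopy X R n =
      (tuples (SimplexPt.{w} n)).ιChainComplex (vertices n) ≫
        subdivTuplesHomotopy R barycentre n ≫ (SSet.chainComplexMap (alongSimplex a) R).f (n + 1) :=
  ι_descChain _ _

/-- Singular subdivision is prescribed only on the tuple of vertices; this extends the prescription
to every tuple, because the simplex given by a tuple v subdivides as the affine image of the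
subdivided standard simplex. As each singular simplex is the image of the tuple of vertices
(`ι_vertices_alongSimplex`), identities for tuples pass to singular chains. -/
lemma alongSimplex_subdiv {n : ℕ} (a : (TopCat.toSSet.obj X) _⦋n⦌) (m : ℕ) :
    (SSet.chainComplexMap (alongSimplex a) R).f m ≫ subdiv X R m =
      subdivTuples R barycentre m ≫ (SSet.chainComplexMap (alongSimplex a) R).f m := by
  apply SSet.chainComplex_hom_ext
  intro v
  rw [SSet.ι_chainComplexMap_f_assoc, ι_subdiv, alongSimplex_alongSimplex, chainComplexMap_comp_f, reassoc_of% subdivTuples_map R (affineMap_barycentre _) m,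
    SSet.ι_chainComplexMap_f_assoc, tuplesMap_affineMap_vertices]

lemma alongSimplex_subdivHomotopy {n : ℕ} (a : (TopCat.toSSet.obj X) _⦋n⦌) (m : ℕ) :
    (SSet.chainComplexMap (alongSimplex a) R).f m ≫ subdivHomotopy X R m =
      subdivTuplesHomotopy R barycentre m ≫
        (SSet.chainComplexMap (alongSimplex a) R).f (m + 1) := by
  apply SSet.chainComplex_hom_ext
  intro v
  rw [SSet.ι_chainComplexMap_f_assoc, ι_subdivHomotopy, alongSimplex_alongSimplex, chainComplexMap_comp_f, reassoc_of% subdivTuplesHomotopy_map R (affineMap_barycentre _) m,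
    SSet.ι_chainComplexMap_f_assoc, tuplesMap_affineMap_vertices]

lemma subdiv_d (n : ℕ) :
    subdiv X R (n + 1) ≫ ((TopCat.toSSet.obj X).chainComplex R).d (n + 1) n =
      ((TopCat.toSSet.obj X).chainComplex R).d (n + 1) n ≫ subdiv X R n := by
  apply SSet.chainComplex_hom_ext
  intro a
  rw [← ι_vertices_alongSimplex, Category.assoc, reassoc_of% alongSimplex_subdiv R a,
    HomologicalComplex.Hom.comm, reassoc_of% subdivTuples_d, Category.assoc,
    HomologicalComplex.Hom.comm_assoc, alongSimplex_subdiv]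

lemma subdivHomotopy_zero_d :
    subdivHomotopy X R 0 ≫ ((TopCat.toSSet.obj X).chainComplex R).d 1 0 = 𝟙 _ - subdiv X R 0 := by
  apply SSet.chainComplex_hom_ext
  intro a
  rw [← ι_vertices_alongSimplex, Category.assoc, reassoc_of% alongSimplex_subdivHomotopy R a,
    HomologicalComplex.Hom.comm, reassoc_of% subdivTuplesHomotopy_zero_d, Category.assoc,
    Preadditive.comp_sub, Preadditive.sub_comp, alongSimplex_subdiv, Category.comp_id,
    Category.id_comp]

lemma subdivHomotopy_succ_d (n : ℕ) :
    subdivHomotopy X R (n + 1) ≫ ((TopCat.toSSet.obj X).chainComplex R).d (n + 2) (n + 1) +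
      ((TopCat.toSSet.obj X).chainComplex R).d (n + 1) n ≫ subdivHomotopy X R n =
      𝟙 _ - subdiv X R (n + 1) := by
  apply SSet.chainComplex_hom_ext
  intro a
  have h := subdivTuplesHomotopy_succ_d R (K := SimplexPt.{w} (n + 1)) barycentre n =≫
    (SSet.chainComplexMap (alongSimplex a) R).f (n + 1)
  rw [← ι_vertices_alongSimplex, Category.assoc, Category.assoc, Preadditive.comp_add,
    Preadditive.comp_sub, reassoc_of% alongSimplex_subdivHomotopy R a,
    HomologicalComplex.Hom.comm, HomologicalComplex.Hom.comm_assoc, alongSimplex_subdivHomotopy,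
    alongSimplex_subdiv, Category.comp_id]
  rw [Preadditive.add_comp, Preadditive.sub_comp, Category.id_comp, Category.assoc,
    Category.assoc] at h
  rw [h]

lemma subdiv_map (f : X ⟶ Y) (n : ℕ) :
    subdiv X R n ≫ (SSet.chainComplexMap (TopCat.toSSet.map f) R).f n =
      (SSet.chainComplexMap (TopCat.toSSet.map f) R).f n ≫ subdiv Y R n := by
  apply SSet.chainComplex_hom_ext
  intro a
  rw [SSet.ι_chainComplexMap_f_assoc, ι_subdiv, alongSimplex_map, chainComplexMap_comp_f, ← Category.assoc, ι_subdiv]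
  simp only [Category.assoc]

end Subdivision

/-! ### Chains supported on a set of simplices -/

section ChainSpan

variable {k : Type v} [Ring k] (R : ModuleCat.{max w v} k) {X Y : SSet.{w}} {n m : ℕ}

/-- The chains which are supported on a set of simplices. -/
def chainSpan (S : Set (X _⦋n⦌)) : Submodule k ((X.chainComplex R).X n) :=
  ⨆ s ∈ S, LinearMap.range (X.ιChainComplex (R := R) s).hom

variable {R}

lemma ι_mem_chainSpan {S : Set (X _⦋n⦌)} {s : X _⦋n⦌} (hs : s ∈ S) (r : R) :
    (X.ιChainComplex (R := R) s).hom r ∈ chainSpan R S :=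
  Submodule.mem_iSup_of_mem s (Submodule.mem_iSup_of_mem hs ⟨r, rfl⟩)

lemma chainSpan_le {S : Set (X _⦋n⦌)} {P : Submodule k ((X.chainComplex R).X n)} :
    chainSpan R S ≤ P ↔ ∀ s ∈ S, ∀ r : R, (X.ιChainComplex (R := R) s).hom r ∈ P := by
  refine ⟨fun h s hs r => h (ι_mem_chainSpan hs r), fun h => iSup₂_le fun s hs => ?_⟩
  rintro _ ⟨r, rfl⟩
  exact h s hs r

lemma chainSpan_mono {S T : Set (X _⦋n⦌)} (h : S ⊆ T) : chainSpan R S ≤ chainSpan R T :=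
  chainSpan_le.2 fun _ hs _ => ι_mem_chainSpan (h hs) _

lemma apply_mem_of_mem_chainSpan {S : Set (X _⦋n⦌)} {T : ModuleCat.{max w v} k}
    (g : (X.chainComplex R).X n ⟶ T) {P : Submodule k T}
    (h : ∀ s ∈ S, ∀ r : R, (X.ιChainComplex s ≫ g).hom r ∈ P) {x : (X.chainComplex R).X n}
    (hx : x ∈ chainSpan R S) : g.hom x ∈ P :=
  (chainSpan_le (P := P.comap g.hom)).2 h hx

/-- The quotient map by this submodule vanishes on every summand of the coproduct of copies of `R`,
hence is zero. -/
lemma chainSpan_univ : chainSpan R (Set.univ : Set (X _⦋n⦌)) = ⊤ := by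
  have h : ModuleCat.ofHom (chainSpan R (Set.univ : Set (X _⦋n⦌))).mkQ = 0 := by
    apply SSet.chainComplex_hom_ext
    intro s
    ext r
    exact (Submodule.Quotient.mk_eq_zero _).2 (ι_mem_chainSpan (Set.mem_univ s) r)
  refine eq_top_iff.2 fun x _ => ?_
  exact (Submodule.Quotient.mk_eq_zero _).1 (congrArg (fun f => f.hom x) h)

lemma chainSpan_union_le (S T : Set (X _⦋n⦌)) :
    chainSpan R (S ∪ T) ≤ chainSpan R S ⊔ chainSpan R T := by
  refine chainSpan_le.2 ?_
  rintro s (hs | hs) r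
  · exact Submodule.mem_sup_left (ι_mem_chainSpan hs r)
  · exact Submodule.mem_sup_right (ι_mem_chainSpan hs r)

open Classical in
lemma chainSpan_inf_le (S T : Set (X _⦋n⦌)) :
    chainSpan R S ⊓ chainSpan R T ≤ chainSpan R (S ∩ T) := by
  -- The projection onto the summands indexed by `S`: it fixes chains supported on `S` and sends
  -- those supported on `T` to chains supported on `S ∩ T`.
  let p : (X.chainComplex R).X n ⟶ (X.chainComplex R).X n :=
    descChain fun s => if s ∈ S then X.ιChainComplex s else 0
  have hp (s : X _⦋n⦌) : X.ιChainComplex s ≫ p = if s ∈ S then X.ιChainComplex s else 0 :=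
    ι_descChain _ _
  rintro x ⟨hS, hT⟩
  have h1 : p.hom x = x := by
    have : x ∈ LinearMap.eqLocus p.hom LinearMap.id := by
      refine chainSpan_le.2 (fun s hs r => ?_) hS
      have := congrArg (fun f => f.hom r) (hp s)
      rwa [if_pos hs] at this
    exact this
  rw [← h1]
  refine apply_mem_of_mem_chainSpan p (fun s hs r => ?_) hT
  rw [hp]
  split_ifs with h
  · exact ι_mem_chainSpan (S := S ∩ T) ⟨h, hs⟩ r
  · exact zero_mem _

lemma range_chainComplexMap (f : X ⟶ Y) (n : ℕ) :
    LinearMap.range ((SSet.chainComplexMap f R).f n).hom =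
      chainSpan R (Set.range (f.app (Opposite.op ⦋n⦌))) := by
  have h (s : X _⦋n⦌) (r : R) : ((SSet.chainComplexMap f R).f n).hom ((X.ιChainComplex (R := R) s).hom r) =
      (Y.ιChainComplex (R := R) (f.app _ s)).hom r :=
    congrArg (fun g => g.hom r) (SSet.ι_chainComplexMap_f X Y f R s)
  apply le_antisymm
  · rintro _ ⟨x, rfl⟩
    have hx : x ∈ chainSpan R (Set.univ : Set (X _⦋n⦌)) := by rw [chainSpan_univ]; trivial
    refine apply_mem_of_mem_chainSpan _ (fun s _ r => ?_) hx
    rw [SSet.ι_chainComplexMap_f]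
    exact ι_mem_chainSpan (Set.mem_range_self s) r
  · refine chainSpan_le.2 ?_
    rintro _ ⟨s, rfl⟩ r
    exact ⟨_, h s r⟩

open Classical in
lemma chainComplexMap_injective {f : X ⟶ Y} (hf : Function.Injective (f.app (Opposite.op ⦋n⦌))) :
    Function.Injective ((SSet.chainComplexMap f R).f n).hom := by
  -- A retraction on chains: a simplex in the image goes to its preimage, any other simplex to 0. It
  -- need not commute with the differential.
  let q : (Y.chainComplex R).X n ⟶ (X.chainComplex R).X n :=
    descChain fun s => if h : ∃ t, f.app (Opposite.op ⦋n⦌) t = s then X.ιChainComplex h.choose else 0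
  have hq : (SSet.chainComplexMap f R).f n ≫ q = 𝟙 _ := by
    apply SSet.chainComplex_hom_ext
    intro t
    have h : ∃ t', f.app (Opposite.op ⦋n⦌) t' = f.app (Opposite.op ⦋n⦌) t := ⟨t, rfl⟩
    rw [SSet.ι_chainComplexMap_f_assoc, ι_descChain, dif_pos h, hf h.choose_spec, Category.comp_id]
  exact Function.LeftInverse.injective (g := q.hom) fun x => congrArg (fun g => g.hom x) hq

end ChainSpan

/-! ### Subdivided simplices are small -/

section Mesh

open SimplexPt

variable {n : ℕ}

/-- The distances of the points of a tuple are at most `D`. -/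
def IsFine {m : ℕ} (D : ℝ) (v : (tuples (SimplexPt.{w} n)) _⦋m⦌) : Prop :=
  ∀ i j : Fin (m + 1), dist (v i) (v j) ≤ D

lemma SimplexPt.dist_eq (p q : SimplexPt.{w} n) : dist p q = ‖p.down.1 - q.down.1‖ := by
  rw [← dist_eq_norm]
  rfl

/-- Closed balls are convex, so a bound at the vertices holds on the whole affine simplex. -/
lemma dist_comb_le {m : ℕ} {p : SimplexPt.{w} n} {v : Fin (m + 1) → SimplexPt.{w} n} {D : ℝ}
    (h : ∀ i, dist (v i) p ≤ D) (t : SimplexPt.{w} m) : dist (comb v t) p ≤ D :=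
  (convex_closedBall p.down.1 D).sum_mem (fun i _ => t.down.2.1 i) t.down.2.2 fun i _ => h i

lemma dist_barycentre_le {m : ℕ} {v : (tuples (SimplexPt.{w} n)) _⦋m⦌} {D : ℝ} (h : IsFine D v)
    (j : Fin (m + 1)) : dist (v j) (barycentre m v) ≤ (m / (m + 1) : ℝ) * D := by
  have hm : ((m : ℝ) + 1) ≠ 0 := by positivity
  have e : (barycentre m v).down.1 - (v j).down.1 =
      ∑ i : Fin (m + 1), ((m : ℝ) + 1)⁻¹ • ((v i).down.1 - (v j).down.1) := by
    simp only [smul_sub, Finset.sum_sub_distrib, Finset.sum_const, Finset.card_univ,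
      Fintype.card_fin, ← Nat.cast_smul_eq_nsmul ℝ, smul_smul]
    rw [Nat.cast_add_one, mul_inv_cancel₀ hm, one_smul]
    rfl
  rw [dist_comm, SimplexPt.dist_eq, e]
  refine (norm_sum_le _ _).trans ?_
  -- The term `i = j` of the average vanishes. Only m of the m + 1 terms contribute, which is why
  -- the factor is smaller than 1.
  have h1 : ∀ i ∈ Finset.univ, ‖((m : ℝ) + 1)⁻¹ • ((v i).down.1 - (v j).down.1)‖ ≤
      if i = j then 0 else ((m : ℝ) + 1)⁻¹ * D := by
    intro i _
    split_ifs with hij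
    · simp [hij]
    · rw [norm_smul, Real.norm_of_nonneg (by positivity), ← SimplexPt.dist_eq]
      gcongr
      exact h i j
  refine (Finset.sum_le_sum h1).trans_eq ?_
  rw [Finset.sum_ite, Finset.sum_const_zero, Finset.sum_const, zero_add, Finset.filter_ne',
    Finset.card_erase_of_mem (Finset.mem_univ _), Finset.card_univ, Fintype.card_fin,
    nsmul_eq_mul]
  simp only [Nat.add_sub_cancel]
  ring

variable {k : Type v} [Ring k] {R : ModuleCat.{max w v} k}

/-- The second condition, that the new points lie in the affine simplex spanned by `v`, is there for
the induction: it bounds their distance to the barycentre of the next simplex, the new cone point.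
-/
lemma subdivTuples_mem_chainSpan (m : ℕ) :
    ∀ {v : (tuples (SimplexPt.{w} n)) _⦋m⦌} {D : ℝ}, IsFine D v → ∀ r : R,
    ((tuples (SimplexPt.{w} n)).ιChainComplex v ≫ subdivTuples R barycentre m).hom r ∈
      chainSpan R {u : (tuples (SimplexPt.{w} n)) _⦋m⦌ |
        IsFine ((m / (m + 1) : ℝ) * D) u ∧ ∀ j : Fin (m + 1), ∃ t, u j = affineMap v t} := by
  induction m with
  | zero =>
    intro v D hv r
    rw [subdivTuples_zero, Category.comp_id]
    refine ι_mem_chainSpan ?_ r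
    refine ⟨fun i j => ?_, fun j => ⟨vertex 0 j, (comb_vertex v j).symm⟩⟩
    obtain rfl := Subsingleton.elim (α := Fin 1) i j
    simp
  | succ m ih =>
    intro v D hv r
    have hD : 0 ≤ D := dist_nonneg.trans (hv 0 0)
    rw [ι_subdivTuples_succ, SSet.ιChainComplex_d_assoc, Preadditive.sum_comp]
    simp only [Preadditive.zsmul_comp]
    rw [ModuleCat.hom_sum, LinearMap.sum_apply]
    refine Submodule.sum_mem _ fun i _ => ?_
    rw [ModuleCat.hom_zsmul, LinearMap.smul_apply]
    refine zsmul_mem ?_ _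
    have hi : IsFine D ((tuples (SimplexPt.{w} n)).δ i v) :=
      fun a b => hv (i.succAbove a) (i.succAbove b)
    rw [← Category.assoc]
    refine apply_mem_of_mem_chainSpan (coneChain R (barycentre (m + 1) v) m) ?_ (ih hi r)
    rintro u ⟨hu1, hu2⟩ s
    rw [ι_coneChain]
    have hull : ∀ j : Fin (m + 1), ∃ t, u j = affineMap v t := fun j => by
      obtain ⟨t, ht⟩ := hu2 j
      exact ⟨_, ht.trans (comb_comp v i.succAbove t)⟩
    have hbary : ∀ j : Fin (m + 1), dist (u j) (barycentre (m + 1) v) ≤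
        (((m + 1 : ℕ) : ℝ) / ((m + 1 : ℕ) + 1)) * D := fun j => by
      obtain ⟨t, ht⟩ := hull j
      rw [ht]
      exact dist_comb_le (dist_barycentre_le hv) t
    -- Edges away from the cone point come from the subdivision of a face, one dimension lower;
    -- m/(m+1) increases with m, so their bound is good enough.
    have hle : ((m : ℝ) / (m + 1)) * D ≤ (((m + 1 : ℕ) : ℝ) / ((m + 1 : ℕ) + 1)) * D := by
      refine mul_le_mul_of_nonneg_right ?_ hD
      rw [div_le_div_iff₀ (by positivity) (by positivity)]
      push_cast
      nlinarith
    refine ι_mem_chainSpan ?_ s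
    refine ⟨fun a b => ?_, fun j => ?_⟩
    · cases a using Fin.cases with
      | zero =>
        cases b using Fin.cases with
        | zero => exact (dist_self _).trans_le (by positivity)
        | succ b => exact (dist_comm _ _).trans_le (hbary b)
      | succ a =>
        cases b using Fin.cases with
        | zero => exact hbary a
        | succ b => exact (hu1 a b).trans hle
    · cases j using Fin.cases with
      | zero => exact ⟨_, rfl⟩
      | succ j => exact hull j

lemma iterate_subdivTuples_mem_chainSpan {m : ℕ} {v : (tuples (SimplexPt.{w} n)) _⦋m⦌} {D : ℝ}
    (hv : IsFine D v) (r : R) (l : ℕ) :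
    (subdivTuples R barycentre m).hom^[l] (((tuples (SimplexPt.{w} n)).ιChainComplex (R := R) v).hom r) ∈
      chainSpan R {u : (tuples (SimplexPt.{w} n)) _⦋m⦌ | IsFine ((m / (m + 1) : ℝ) ^ l * D) u} := by
  induction l with
  | zero => exact ι_mem_chainSpan (by simpa using hv) r
  | succ l ih =>
    rw [Function.iterate_succ_apply']
    refine apply_mem_of_mem_chainSpan _ (fun u hu s => ?_) ih
    refine chainSpan_mono ?_ (subdivTuples_mem_chainSpan m hu s)
    rintro x ⟨hx, -⟩
    rwa [← mul_assoc, ← pow_succ'] at hx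

end Mesh

/-! ### Small chains -/

section Small

variable {k : Type v} [Ring k] {R : ModuleCat.{max w v} k} {X : TopCat.{w}}

/-- The singular simplices with values in a subset. -/
def simplicesIn (U : Set X) (n : ℕ) : Set ((TopCat.toSSet.obj X) _⦋n⦌) :=
  {a | ∀ t, simplexMap a t ∈ U}

lemma range_alongSimplex_subset {U : Set X} {n : ℕ} {a : (TopCat.toSSet.obj X) _⦋n⦌}
    (ha : a ∈ simplicesIn U n) (m : ℕ) :
    Set.range ((alongSimplex a).app (Opposite.op ⦋m⦌)) ⊆ simplicesIn U m := by
  rintro _ ⟨v, rfl⟩ t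
  exact ha _

/-- The subdivision of a simplex a is the image of a chain under `alongSimplex a`, and all simplices
in the image of this map factor through a. -/
lemma subdiv_mem_chainSpan {U : Set X} {n : ℕ} {x : ((TopCat.toSSet.obj X).chainComplex R).X n}
    (hx : x ∈ chainSpan R (simplicesIn U n)) :
    (subdiv X R n).hom x ∈ chainSpan R (simplicesIn U n) := by
  refine apply_mem_of_mem_chainSpan _ (fun a ha r => ?_) hx
  refine chainSpan_mono (range_alongSimplex_subset ha n) ?_
  rw [ι_subdiv, ← range_chainComplexMap]
  exact ⟨_, rfl⟩

lemma subdivHomotopy_mem_chainSpan {U : Set X} {n : ℕ}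
    {x : ((TopCat.toSSet.obj X).chainComplex R).X n} (hx : x ∈ chainSpan R (simplicesIn U n)) :
    (subdivHomotopy X R n).hom x ∈ chainSpan R (simplicesIn U (n + 1)) := by
  refine apply_mem_of_mem_chainSpan _ (fun a ha r => ?_) hx
  refine chainSpan_mono (range_alongSimplex_subset ha (n + 1)) ?_
  rw [ι_subdivHomotopy, ← range_chainComplexMap]
  exact ⟨_, rfl⟩

lemma iterate_subdiv_mem_chainSpan {U : Set X} {n : ℕ}
    {x : ((TopCat.toSSet.obj X).chainComplex R).X n} (hx : x ∈ chainSpan R (simplicesIn U n))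
    (l : ℕ) : (subdiv X R n).hom^[l] x ∈ chainSpan R (simplicesIn U n) := by
  induction l with
  | zero => exact hx
  | succ l ih =>
    rw [Function.iterate_succ_apply']
    exact subdiv_mem_chainSpan ih

/-- Moves the iteration from X, which has no metric, into the standard simplex, where the size of
simplices can be estimated. -/
lemma iterate_subdiv_ι {n : ℕ} (a : (TopCat.toSSet.obj X) _⦋n⦌) (r : R) (l : ℕ) :
    (subdiv X R n).hom^[l] (((TopCat.toSSet.obj X).ιChainComplex (R := R) a).hom r) =
      ((SSet.chainComplexMap (alongSimplex a) R).f n).hom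
        ((subdivTuples R SimplexPt.barycentre n).hom^[l]
          (((tuples (SimplexPt.{w} n)).ιChainComplex (R := R) (vertices n)).hom r)) := by
  have h1 : Function.Semiconj ((SSet.chainComplexMap (alongSimplex a) R).f n).hom
      (subdivTuples R SimplexPt.barycentre n).hom (subdiv X R n).hom :=
    fun x => congrArg (fun g => g.hom x) (alongSimplex_subdiv R a n).symm
  rw [(h1.iterate_right l).eq, ← ι_vertices_alongSimplex]
  rfl

/-- Pull the cover back to the compact standard simplex, take a Lebesgue number δ, and subdivide
until the simplices have diameter less than δ. -/
lemma exists_iterate_subdiv_ι_mem {U V : Set X} (hU : IsOpen U) (hV : IsOpen V)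
    (hUV : U ∪ V = Set.univ) {n : ℕ} (a : (TopCat.toSSet.obj X) _⦋n⦌) :
    ∃ l, ∀ r : R, (subdiv X R n).hom^[l] (((TopCat.toSSet.obj X).ιChainComplex (R := R) a).hom r) ∈
      chainSpan R (simplicesIn U n ∪ simplicesIn V n) := by
  obtain ⟨δ, hδ, hball⟩ := lebesgue_number_lemma_of_metric (ι := Bool)
    (s := (Set.univ : Set (SimplexPt.{w} n)))
    (c := fun b => simplexMap a ⁻¹' (if b then U else V)) isCompact_univ
    (fun b => by
      cases b
      · exact hV.preimage (simplexMap a).continuous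
      · exact hU.preimage (simplexMap a).continuous)
    (fun t _ => by
      rcases (hUV ▸ Set.mem_univ _ : simplexMap a t ∈ U ∪ V) with h | h
      · exact Set.mem_iUnion.2 ⟨true, h⟩
      · exact Set.mem_iUnion.2 ⟨false, h⟩)
  have hfine : IsFine (Metric.diam (Set.univ : Set (SimplexPt.{w} n))) (vertices n) := fun i j =>
    Metric.dist_le_diam_of_mem isCompact_univ.isBounded (Set.mem_univ _) (Set.mem_univ _)
  obtain ⟨l, hl⟩ : ∃ l : ℕ,
      (n / (n + 1) : ℝ) ^ l * Metric.diam (Set.univ : Set (SimplexPt.{w} n)) < δ := by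
    have h1 : Filter.Tendsto (fun l : ℕ => (n / (n + 1) : ℝ) ^ l *
        Metric.diam (Set.univ : Set (SimplexPt.{w} n))) Filter.atTop (nhds (0 * _)) :=
      (tendsto_pow_atTop_nhds_zero_of_lt_one (by positivity)
        ((div_lt_one (by positivity)).2 (lt_add_one _))).mul_const _
    rw [zero_mul] at h1
    exact (h1.eventually_lt_const hδ).exists
  refine ⟨l, fun r => ?_⟩
  rw [iterate_subdiv_ι]
  refine apply_mem_of_mem_chainSpan _ (fun u hu s => ?_)
    (iterate_subdivTuples_mem_chainSpan hfine r l)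
  rw [SSet.ι_chainComplexMap_f]
  refine ι_mem_chainSpan ?_ s
  -- The ball is centred at the first vertex of the small simplex. All vertices lie in it, hence by
  -- convexity so does the simplex.
  obtain ⟨b, hb⟩ := hball (affineMap u (SimplexPt.vertex n 0)) (Set.mem_univ _)
  have hmem : ∀ t, simplexMap ((alongSimplex a).app _ u) t ∈ (if b then U else V) := fun t => by
    refine hb (Metric.mem_ball.2 ((dist_comb_le (fun i => ?_) t).trans_lt hl))
    exact (congrArg (dist (u i)) (SimplexPt.comb_vertex u 0)).trans_le (hu i 0)
  cases b
  · exact Or.inr hmem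
  · exact Or.inl hmem

/-- Every singular chain becomes small with respect to an open cover after sufficiently many
subdivisions. -/
lemma exists_iterate_subdiv_mem {U V : Set X} (hU : IsOpen U) (hV : IsOpen V)
    (hUV : U ∪ V = Set.univ) {n : ℕ} (x : ((TopCat.toSSet.obj X).chainComplex R).X n) :
    ∃ l, (subdiv X R n).hom^[l] x ∈
      chainSpan R (simplicesIn U n) ⊔ chainSpan R (simplicesIn V n) := by
  -- Small chains stay small under further subdivision, so two chains that need different numbers of
  -- subdivisions can be brought to a common one. This makes the eventually small chains the
  -- submodule `P`.
  have hstep : ∀ y ∈ chainSpan R (simplicesIn U n) ⊔ chainSpan R (simplicesIn V n), ∀ l,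
      (subdiv X R n).hom^[l] y ∈
        chainSpan R (simplicesIn U n) ⊔ chainSpan R (simplicesIn V n) := by
    intro y hy l
    obtain ⟨y₁, h₁, y₂, h₂, rfl⟩ := Submodule.mem_sup.1 hy
    rw [iterate_map_add]
    exact Submodule.add_mem_sup (iterate_subdiv_mem_chainSpan h₁ l)
      (iterate_subdiv_mem_chainSpan h₂ l)
  let P : Submodule k (((TopCat.toSSet.obj X).chainComplex R).X n) :=
    { carrier := {y | ∃ l, (subdiv X R n).hom^[l] y ∈
        chainSpan R (simplicesIn U n) ⊔ chainSpan R (simplicesIn V n)}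
      zero_mem' := ⟨0, zero_mem _⟩
      add_mem' := by
        rintro y z ⟨l, hl⟩ ⟨m, hm⟩
        refine ⟨l + m, ?_⟩
        rw [iterate_map_add]
        refine add_mem ?_ ?_
        · rw [add_comm l m, Function.iterate_add_apply]
          exact hstep _ hl m
        · rw [Function.iterate_add_apply]
          exact hstep _ hm l
      smul_mem' := by
        rintro c y ⟨l, hl⟩
        refine ⟨l, ?_⟩
        rw [← Module.End.pow_apply, map_smul, Module.End.pow_apply]
        exact Submodule.smul_mem _ _ hl }
  have hP : chainSpan R Set.univ ≤ P := chainSpan_le.2 fun a _ r => by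
    obtain ⟨l, hl⟩ := exists_iterate_subdiv_ι_mem (R := R) hU hV hUV a
    exact ⟨l, chainSpan_union_le _ _ (hl r)⟩
  rw [chainSpan_univ] at hP
  exact hP trivial

end Small

/-! ### Homology of complexes of modules in terms of elements -/

section Elements

variable {k : Type v} [Ring k]

lemma exists_cycle (K : ChainComplex (ModuleCat.{u} k) ℕ) {n j : ℕ}
    (hj : (ComplexShape.down ℕ).next n = j) {x : K.X n} (hx : (K.d n j).hom x = 0) :
    ∃ z : K.cycles n, (K.iCycles n).hom z = x := by
  let p : ModuleCat.of k (LinearMap.ker (K.d n j).hom) ⟶ K.X n :=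
    ModuleCat.ofHom (LinearMap.ker (K.d n j).hom).subtype
  have hp : p ≫ K.d n j = 0 := by
    ext y
    exact y.2
  refine ⟨(K.liftCycles p j hj hp).hom ⟨x, hx⟩, ?_⟩
  exact congrArg (fun g => g.hom ⟨x, hx⟩) (K.liftCycles_i p j hj hp)

/-- Homology is a cokernel of `toCycles`, so the projection of cycles to their quotient by
boundaries factors through it; a cycle that dies in homology also dies in that quotient. -/
lemma exists_toCycles_eq (K : ChainComplex (ModuleCat.{u} k) ℕ) {n : ℕ} {z : K.cycles n}
    (hz : (K.homologyπ n).hom z = 0) : ∃ y : K.X (n + 1), (K.toCycles (n + 1) n).hom y = z := by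
  let q : K.cycles n ⟶ ModuleCat.of k (K.cycles n ⧸ LinearMap.range (K.toCycles (n + 1) n).hom) :=
    ModuleCat.ofHom (LinearMap.range (K.toCycles (n + 1) n).hom).mkQ
  have hq : K.toCycles (n + 1) n ≫ q = 0 := by
    ext y
    exact (Submodule.Quotient.mk_eq_zero _).2 ⟨y, rfl⟩
  obtain ⟨g, hg⟩ : ∃ g, K.homologyπ n ≫ g = q :=
    ⟨_, (K.homologyIsCokernel (n + 1) n (by simp)).fac (CokernelCofork.ofπ q hq)
      WalkingParallelPair.one⟩
  have h1 : g.hom ((K.homologyπ n).hom z) = q.hom z := congrArg (fun g => g.hom z) hg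
  rw [hz, map_zero] at h1
  exact (Submodule.Quotient.mk_eq_zero _).1 h1.symm

/-- A criterion, in terms of elements, for a map of complexes to be an isomorphism in homology. -/
lemma isIso_homologyMap {K L : ChainComplex (ModuleCat.{u} k) ℕ} (f : K ⟶ L) {n j : ℕ}
    (hj : (ComplexShape.down ℕ).next n = j)
    (surj : ∀ y : L.X n, (L.d n j).hom y = 0 → ∃ x : K.X n, (K.d n j).hom x = 0 ∧
      ∃ z : L.X (n + 1), (f.f n).hom x = y + (L.d (n + 1) n).hom z)
    (inj : ∀ x : K.X n, (K.d n j).hom x = 0 → (∃ z, (f.f n).hom x = (L.d (n + 1) n).hom z) →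
      ∃ z, x = (K.d (n + 1) n).hom z) :
    IsIso (HomologicalComplex.homologyMap f n) := by
  have hKπ : Function.Surjective (K.homologyπ n).hom :=
    (ModuleCat.epi_iff_surjective _).1 inferInstance
  have hLπ : Function.Surjective (L.homologyπ n).hom :=
    (ModuleCat.epi_iff_surjective _).1 inferInstance
  have hKi : Function.Injective (K.iCycles n).hom :=
    (ModuleCat.mono_iff_injective _).1 inferInstance
  have hLi : Function.Injective (L.iCycles n).hom :=
    (ModuleCat.mono_iff_injective _).1 inferInstance
  have hnat (z : K.cycles n) : (HomologicalComplex.homologyMap f n).hom ((K.homologyπ n).hom z) =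
      (L.homologyπ n).hom ((HomologicalComplex.cyclesMap f n).hom z) :=
    congrArg (fun g => g.hom z) (HomologicalComplex.homologyπ_naturality f n)
  have hcyc (z : K.cycles n) : (L.iCycles n).hom ((HomologicalComplex.cyclesMap f n).hom z) =
      (f.f n).hom ((K.iCycles n).hom z) :=
    congrArg (fun g => g.hom z) (HomologicalComplex.cyclesMap_i f n)
  have hdK (z : K.cycles n) : (K.d n j).hom ((K.iCycles n).hom z) = 0 :=
    congrArg (fun g => g.hom z) (K.iCycles_d n j)
  have hdL (z : L.cycles n) : (L.d n j).hom ((L.iCycles n).hom z) = 0 :=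
    congrArg (fun g => g.hom z) (L.iCycles_d n j)
  have hiK (z : K.X (n + 1)) : (K.iCycles n).hom ((K.toCycles (n + 1) n).hom z) =
      (K.d (n + 1) n).hom z := congrArg (fun g => g.hom z) (K.toCycles_i (n + 1) n)
  have hiL (z : L.X (n + 1)) : (L.iCycles n).hom ((L.toCycles (n + 1) n).hom z) =
      (L.d (n + 1) n).hom z := congrArg (fun g => g.hom z) (L.toCycles_i (n + 1) n)
  have hπK (z : K.X (n + 1)) : (K.homologyπ n).hom ((K.toCycles (n + 1) n).hom z) = 0 :=
    congrArg (fun g => g.hom z) (K.toCycles_comp_homologyπ (n + 1) n)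
  have hπL (z : L.X (n + 1)) : (L.homologyπ n).hom ((L.toCycles (n + 1) n).hom z) = 0 :=
    congrArg (fun g => g.hom z) (L.toCycles_comp_homologyπ (n + 1) n)
  rw [ConcreteCategory.isIso_iff_bijective]
  constructor
  · refine (injective_iff_map_eq_zero (HomologicalComplex.homologyMap f n).hom).2 fun a ha => ?_
    obtain ⟨z, rfl⟩ := hKπ a
    rw [hnat] at ha
    obtain ⟨y, hy⟩ := exists_toCycles_eq L ha
    obtain ⟨x, hx⟩ := inj _ (hdK z) ⟨y, by rw [← hcyc, ← hy, hiL]⟩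
    have : z = (K.toCycles (n + 1) n).hom x := hKi (by rw [hx, hiK])
    rw [this, hπK]
  · intro b
    obtain ⟨z, rfl⟩ := hLπ b
    obtain ⟨x, hx, y, hy⟩ := surj _ (hdL z)
    obtain ⟨c, rfl⟩ := exists_cycle K hj hx
    refine ⟨(K.homologyπ n).hom c, ?_⟩
    have h1 : (HomologicalComplex.cyclesMap f n).hom c = z + (L.toCycles (n + 1) n).hom y :=
      hLi (by rw [hcyc, hy, map_add, hiL])
    exact (hnat c).trans (by rw [h1, map_add, hπL, add_zero])

variable {K L : ChainComplex (ModuleCat.{u} k) ℕ} (φ : K ⟶ L)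

lemma cokernel_π_f_surjective (m : ℕ) : Function.Surjective ((cokernel.π φ).f m).hom := by
  have : Epi ((cokernel.π φ).f m) :=
    inferInstanceAs (Epi ((HomologicalComplex.eval _ (ComplexShape.down ℕ) m).map (cokernel.π φ)))
  exact (ModuleCat.epi_iff_surjective _).1 this

/-- The cokernel of complexes is computed degreewise, so its projection can be tested against the
quotient module by the range of φ. This is what lets relative cycles be written as chains with
boundary in a submodule. -/
lemma cokernel_π_f_eq_zero_iff {m : ℕ} {x : L.X m} :
    ((cokernel.π φ).f m).hom x = 0 ↔ x ∈ LinearMap.range (φ.f m).hom := by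
  constructor
  · intro hx
    let q : L.X m ⟶ ModuleCat.of k (L.X m ⧸ LinearMap.range (φ.f m).hom) :=
      ModuleCat.ofHom (LinearMap.range (φ.f m).hom).mkQ
    have hq : φ.f m ≫ q = 0 := by
      ext y
      exact (Submodule.Quotient.mk_eq_zero _).2 ⟨y, rfl⟩
    obtain ⟨g, hg⟩ : ∃ g, (cokernel.π φ).f m ≫ g = q := ⟨_, π_cokernelDesc φ q hq⟩
    have h1 : g.hom (((cokernel.π φ).f m).hom x) = q.hom x := congrArg (fun g => g.hom x) hg
    rw [hx, map_zero] at h1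
    exact (Submodule.Quotient.mk_eq_zero _).1 h1.symm
  · rintro ⟨y, rfl⟩
    have : φ.f m ≫ (cokernel.π φ).f m = 0 := by
      rw [← HomologicalComplex.comp_f, cokernel.condition, HomologicalComplex.zero_f]
    exact congrArg (fun g => g.hom y) this

/-- A criterion, in terms of elements, for a map of quotient complexes to be an isomorphism in
homology. -/
lemma isIso_homologyMap_cokernelMap {K' L' : ChainComplex (ModuleCat.{u} k) ℕ} (φ' : K' ⟶ L')
    (f : K ⟶ K') (g : L ⟶ L') (w : φ ≫ g = f ≫ φ') {n j : ℕ}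
    (hj : (ComplexShape.down ℕ).next n = j)
    (surj : ∀ y : L'.X n, (L'.d n j).hom y ∈ LinearMap.range (φ'.f j).hom →
      ∃ x : L.X n, (L.d n j).hom x ∈ LinearMap.range (φ.f j).hom ∧ ∃ z : L'.X (n + 1),
        (g.f n).hom x - (y + (L'.d (n + 1) n).hom z) ∈ LinearMap.range (φ'.f n).hom)
    (inj : ∀ x : L.X n, (L.d n j).hom x ∈ LinearMap.range (φ.f j).hom →
      (∃ z, (g.f n).hom x - (L'.d (n + 1) n).hom z ∈ LinearMap.range (φ'.f n).hom) →
      ∃ z, x - (L.d (n + 1) n).hom z ∈ LinearMap.range (φ.f n).hom) :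
    IsIso (HomologicalComplex.homologyMap (cokernel.map φ φ' f g w) n) := by
  have hd (i j : ℕ) (x : L.X i) : ((cokernel φ).d i j).hom (((cokernel.π φ).f i).hom x) =
      ((cokernel.π φ).f j).hom ((L.d i j).hom x) :=
    congrArg (fun g => g.hom x) ((cokernel.π φ).comm i j)
  have hd' (i j : ℕ) (x : L'.X i) : ((cokernel φ').d i j).hom (((cokernel.π φ').f i).hom x) =
      ((cokernel.π φ').f j).hom ((L'.d i j).hom x) :=
    congrArg (fun g => g.hom x) ((cokernel.π φ').comm i j)
  have hm (x : L.X n) : ((cokernel.map φ φ' f g w).f n).hom (((cokernel.π φ).f n).hom x) =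
      ((cokernel.π φ').f n).hom ((g.f n).hom x) := by
    have : cokernel.π φ ≫ cokernel.map φ φ' f g w = g ≫ cokernel.π φ' := cokernel.π_desc _ _ _
    have h := HomologicalComplex.congr_hom this n
    rw [HomologicalComplex.comp_f, HomologicalComplex.comp_f] at h
    exact congrArg (fun g => g.hom x) h
  refine isIso_homologyMap _ hj (fun y hy => ?_) (fun x hx => ?_)
  · obtain ⟨y, rfl⟩ := cokernel_π_f_surjective φ' n y
    rw [hd', cokernel_π_f_eq_zero_iff] at hy
    obtain ⟨x, hx, z, hz⟩ := surj y hy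
    refine ⟨((cokernel.π φ).f n).hom x, ?_, ((cokernel.π φ').f (n + 1)).hom z, ?_⟩
    · rwa [hd, cokernel_π_f_eq_zero_iff]
    · rw [hm, hd', ← map_add, ← sub_eq_zero, ← map_sub, cokernel_π_f_eq_zero_iff]
      exact hz
  · obtain ⟨x, rfl⟩ := cokernel_π_f_surjective φ n x
    rintro ⟨z, hz⟩
    obtain ⟨z, rfl⟩ := cokernel_π_f_surjective φ' (n + 1) z
    rw [hd, cokernel_π_f_eq_zero_iff] at hx
    rw [hm, hd', ← sub_eq_zero, ← map_sub, cokernel_π_f_eq_zero_iff] at hz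
    obtain ⟨t, ht⟩ := inj x hx ⟨z, hz⟩
    refine ⟨((cokernel.π φ).f (n + 1)).hom t, ?_⟩
    rwa [hd, ← sub_eq_zero, ← map_sub, cokernel_π_f_eq_zero_iff]

end Elements

/-! ### Excision -/

section Excision

lemma range_toSSet_map {X Y : TopCat.{w}} {f : X ⟶ Y} (hf : Topology.IsEmbedding f) (n : ℕ) :
    Set.range ((TopCat.toSSet.map f).app (Opposite.op ⦋n⦌)) = simplicesIn (Set.range f) n := by
  ext a
  constructor
  · rintro ⟨b, rfl⟩ t
    exact ⟨simplexMap b t, rfl⟩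
  · intro ha
    choose g hg using ha
    have hc : Continuous g := by
      rw [hf.continuous_iff]
      exact (simplexMap a).continuous.congr fun t => (hg t).symm
    exact ⟨ofSimplexMap ⟨g, hc⟩, simplexMap_injective (ContinuousMap.ext hg)⟩

lemma toSSet_map_injective {X Y : TopCat.{w}} {f : X ⟶ Y} (hf : Function.Injective f) (n : ℕ) :
    Function.Injective ((TopCat.toSSet.map f).app (Opposite.op ⦋n⦌)) := fun _ _ h =>
  simplexMap_injective (ContinuousMap.ext fun t =>
    hf (congrArg (fun c => simplexMap (n := n) c t) h))

variable {k : Type v} [Ring k] {R : ModuleCat.{max w v} k} {X Y : TopCat.{w}}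

variable (R) in
lemma range_chainComplexMap_ofSubset (A : Set X) (n : ℕ) :
    LinearMap.range ((SSet.chainComplexMap
      (TopCat.toSSet.map (TopPair.ofSubset A).map) R).f n).hom = chainSpan R (simplicesIn A n) := by
  rw [range_chainComplexMap, range_toSSet_map (TopPair.ofSubset A).isEmbedding_map]
  congr 2
  exact Subtype.range_val

lemma d_mem_chainSpan {A : Set X} {i : ℕ} (j : ℕ)
    {x : ((TopCat.toSSet.obj X).chainComplex R).X i} (hx : x ∈ chainSpan R (simplicesIn A i)) :
    (((TopCat.toSSet.obj X).chainComplex R).d i j).hom x ∈ chainSpan R (simplicesIn A j) := by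
  rw [← range_chainComplexMap_ofSubset] at hx ⊢
  obtain ⟨y, rfl⟩ := hx
  exact ⟨_, (congrArg (fun g => g.hom y) ((SSet.chainComplexMap
    (TopCat.toSSet.map (TopPair.ofSubset A).map) R).comm i j)).symm⟩

lemma d_iterate_subdiv (i j : ℕ) (x : ((TopCat.toSSet.obj X).chainComplex R).X i) (l : ℕ) :
    (((TopCat.toSSet.obj X).chainComplex R).d i j).hom ((subdiv X R i).hom^[l] x) =
      (subdiv X R j).hom^[l] ((((TopCat.toSSet.obj X).chainComplex R).d i j).hom x) := by
  have h : subdiv X R i ≫ ((TopCat.toSSet.obj X).chainComplex R).d i j =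
      ((TopCat.toSSet.obj X).chainComplex R).d i j ≫ subdiv X R j := by
    by_cases hij : j + 1 = i
    · subst hij
      exact subdiv_d R j
    · rw [HomologicalComplex.shape _ _ _ hij, comp_zero, zero_comp]
  have h1 : Function.Semiconj (((TopCat.toSSet.obj X).chainComplex R).d i j).hom
      (subdiv X R i).hom (subdiv X R j).hom := fun x => congrArg (fun g => g.hom x) h
  exact (h1.iterate_right l).eq x

lemma map_iterate_subdiv (f : X ⟶ Y) (n : ℕ) (x : ((TopCat.toSSet.obj X).chainComplex R).X n)
    (l : ℕ) :
    ((SSet.chainComplexMap (TopCat.toSSet.map f) R).f n).hom ((subdiv X R n).hom^[l] x) =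
      (subdiv Y R n).hom^[l] (((SSet.chainComplexMap (TopCat.toSSet.map f) R).f n).hom x) := by
  have h1 : Function.Semiconj ((SSet.chainComplexMap (TopCat.toSSet.map f) R).f n).hom
      (subdiv X R n).hom (subdiv Y R n).hom :=
    fun x => congrArg (fun g => g.hom x) (subdiv_map R f n)
  exact (h1.iterate_right l).eq x

/-- For a relative cycle x the difference x - S x - ∂T x equals T∂x, and T preserves chains in `A`.
In degree 0 there is no such term and the difference is zero. -/
lemma sub_subdiv_sub_d_mem {A : Set X} {n j : ℕ} (hj : (ComplexShape.down ℕ).next n = j)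
    {x : ((TopCat.toSSet.obj X).chainComplex R).X n}
    (hx : (((TopCat.toSSet.obj X).chainComplex R).d n j).hom x ∈ chainSpan R (simplicesIn A j)) :
    x - (subdiv X R n).hom x -
      (((TopCat.toSSet.obj X).chainComplex R).d (n + 1) n).hom ((subdivHomotopy X R n).hom x) ∈
        chainSpan R (simplicesIn A n) := by
  cases n with
  | zero =>
    have h := congrArg (fun g => g.hom x) (subdivHomotopy_zero_d (X := X) R)
    have h1 : (((TopCat.toSSet.obj X).chainComplex R).d 1 0).hom ((subdivHomotopy X R 0).hom x) =
      x - (subdiv X R 0).hom x := h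
    rw [h1, sub_self]
    exact zero_mem _
  | succ n =>
    obtain rfl : n = j := by simpa using hj
    have h := congrArg (fun g => g.hom x) (subdivHomotopy_succ_d (X := X) R n)
    have h1 : (((TopCat.toSSet.obj X).chainComplex R).d (n + 2) (n + 1)).hom
        ((subdivHomotopy X R (n + 1)).hom x) + (subdivHomotopy X R n).hom
          ((((TopCat.toSSet.obj X).chainComplex R).d (n + 1) n).hom x) =
        x - (subdiv X R (n + 1)).hom x := h
    rw [← h1, add_sub_cancel_left]
    exact subdivHomotopy_mem_chainSpan hx

lemma exists_sub_iterate_subdiv_sub_d_mem {A : Set X} {n j : ℕ}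
    (hj : (ComplexShape.down ℕ).next n = j) {x : ((TopCat.toSSet.obj X).chainComplex R).X n}
    (hx : (((TopCat.toSSet.obj X).chainComplex R).d n j).hom x ∈ chainSpan R (simplicesIn A j))
    (l : ℕ) : ∃ z, x - (subdiv X R n).hom^[l] x -
      (((TopCat.toSSet.obj X).chainComplex R).d (n + 1) n).hom z ∈
        chainSpan R (simplicesIn A n) := by
  induction l with
  | zero => exact ⟨0, by simp⟩
  | succ l ih =>
    obtain ⟨z, hz⟩ := ih
    have hl : (((TopCat.toSSet.obj X).chainComplex R).d n j).hom ((subdiv X R n).hom^[l] x) ∈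
        chainSpan R (simplicesIn A j) := by
      rw [d_iterate_subdiv]
      exact iterate_subdiv_mem_chainSpan hx l
    refine ⟨z + (subdivHomotopy X R n).hom ((subdiv X R n).hom^[l] x), ?_⟩
    convert! add_mem hz (sub_subdiv_sub_d_mem hj hl) using 1
    rw [map_add, Function.iterate_succ_apply']
    abel

/-- The image chain is supported both on simplices in the range of f and on simplices in `B`, hence
on those in both. Such simplices lift to f⁻¹(B), and injectivity on chains identifies the lifted
chain with x. -/
lemma mem_chainSpan_of_map_mem {f : X ⟶ Y} (hf : Topology.IsEmbedding f) {B : Set Y} {n : ℕ}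
    {x : ((TopCat.toSSet.obj X).chainComplex R).X n}
    (hx : ((SSet.chainComplexMap (TopCat.toSSet.map f) R).f n).hom x ∈
      chainSpan R (simplicesIn B n)) : x ∈ chainSpan R (simplicesIn (f ⁻¹' B) n) := by
  have h1 : ((SSet.chainComplexMap (TopCat.toSSet.map f) R).f n).hom x ∈
      chainSpan R (simplicesIn (Set.range f) n) := by
    rw [← range_toSSet_map hf, ← range_chainComplexMap]
    exact ⟨x, rfl⟩
  have h2 := chainSpan_inf_le _ _ ⟨h1, hx⟩
  have h3 : chainSpan R (simplicesIn (Set.range f) n ∩ simplicesIn B n) ≤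
      (chainSpan R (simplicesIn (f ⁻¹' B) n)).map
        ((SSet.chainComplexMap (TopCat.toSSet.map f) R).f n).hom := by
    refine chainSpan_le.2 ?_
    rintro s ⟨hs, hsB⟩ r
    rw [← range_toSSet_map hf] at hs
    obtain ⟨t, rfl⟩ := hs
    refine ⟨_, ι_mem_chainSpan (s := t) hsB r, ?_⟩
    exact LinearMap.congr_fun (congrArg ModuleCat.Hom.hom (SSet.ι_chainComplexMap_f
      (TopCat.toSSet.obj X) (TopCat.toSSet.obj Y) (TopCat.toSSet.map f) R t)) r
  obtain ⟨y, hy, hyx⟩ := h3 h2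
  rwa [← chainComplexMap_injective (toSSet_map_injective hf.injective n) hyx]

lemma exists_map_eq_of_mem_chainSpan {f : X ⟶ Y} (hf : Topology.IsEmbedding f) {n : ℕ}
    {y : ((TopCat.toSSet.obj Y).chainComplex R).X n}
    (hy : y ∈ chainSpan R (simplicesIn (Set.range f) n)) :
    ∃ x, ((SSet.chainComplexMap (TopCat.toSSet.map f) R).f n).hom x = y := by
  rwa [← range_toSSet_map hf, ← range_chainComplexMap] at hy

lemma d_map (f : X ⟶ Y) (i j : ℕ) (x : ((TopCat.toSSet.obj X).chainComplex R).X i) :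
    (((TopCat.toSSet.obj Y).chainComplex R).d i j).hom
      (((SSet.chainComplexMap (TopCat.toSSet.map f) R).f i).hom x) =
    ((SSet.chainComplexMap (TopCat.toSSet.map f) R).f j).hom
      ((((TopCat.toSSet.obj X).chainComplex R).d i j).hom x) :=
  LinearMap.congr_fun (congrArg ModuleCat.Hom.hom
    ((SSet.chainComplexMap (TopCat.toSSet.map f) R).comm i j)) x

/-- Surjectivity in excision: after enough subdivisions a relative cycle y becomes f_* x + b with b
in `B`. It is homologous to y modulo `B`, and ∂ f_* x = S^l ∂y - ∂b lies in `B`, so x is a relative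
cycle. -/
lemma exists_relCycle_of_cover {f : X ⟶ Y} (hf : Topology.IsOpenEmbedding f) {B : Set Y}
    (hB : IsOpen B) (hcover : Set.range f ∪ B = Set.univ) {n j : ℕ}
    (hj : (ComplexShape.down ℕ).next n = j) {y : ((TopCat.toSSet.obj Y).chainComplex R).X n}
    (hy : (((TopCat.toSSet.obj Y).chainComplex R).d n j).hom y ∈ chainSpan R (simplicesIn B j)) :
    ∃ x, (((TopCat.toSSet.obj X).chainComplex R).d n j).hom x ∈
        chainSpan R (simplicesIn (f ⁻¹' B) j) ∧
      ∃ z, ((SSet.chainComplexMap (TopCat.toSSet.map f) R).f n).hom x -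
        (y + (((TopCat.toSSet.obj Y).chainComplex R).d (n + 1) n).hom z) ∈
          chainSpan R (simplicesIn B n) := by
  obtain ⟨l, hl⟩ := exists_iterate_subdiv_mem hf.isOpen_range hB hcover y
  obtain ⟨a, ha, b, hb, hab⟩ := Submodule.mem_sup.1 hl
  obtain ⟨x, rfl⟩ := exists_map_eq_of_mem_chainSpan hf.isEmbedding ha
  obtain ⟨z, hz⟩ := exists_sub_iterate_subdiv_sub_d_mem hj hy l
  refine ⟨x, mem_chainSpan_of_map_mem hf.isEmbedding ?_, -z, ?_⟩
  · rw [← d_map, eq_sub_of_add_eq hab, map_sub, d_iterate_subdiv]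
    exact sub_mem (iterate_subdiv_mem_chainSpan hy l) (d_mem_chainSpan _ hb)
  · rw [eq_sub_of_add_eq hab, map_neg]
    convert! neg_mem (add_mem hz hb) using 1
    abel

/-- Injectivity in excision: subdivide the bounding chain z into f_* c + b with b in `B`. Then
f_*(S^l x - ∂c) lies in `B`, so S^l x is a boundary modulo f⁻¹(B), and x differs from S^l x by
another such boundary. -/
lemma exists_sub_d_mem_of_cover {f : X ⟶ Y} (hf : Topology.IsOpenEmbedding f) {B : Set Y}
    (hB : IsOpen B) (hcover : Set.range f ∪ B = Set.univ) {n j : ℕ}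
    (hj : (ComplexShape.down ℕ).next n = j) {x : ((TopCat.toSSet.obj X).chainComplex R).X n}
    (hx : (((TopCat.toSSet.obj X).chainComplex R).d n j).hom x ∈
      chainSpan R (simplicesIn (f ⁻¹' B) j))
    {z : ((TopCat.toSSet.obj Y).chainComplex R).X (n + 1)}
    (hz : ((SSet.chainComplexMap (TopCat.toSSet.map f) R).f n).hom x -
      (((TopCat.toSSet.obj Y).chainComplex R).d (n + 1) n).hom z ∈
        chainSpan R (simplicesIn B n)) :
    ∃ t, x - (((TopCat.toSSet.obj X).chainComplex R).d (n + 1) n).hom t ∈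
      chainSpan R (simplicesIn (f ⁻¹' B) n) := by
  obtain ⟨l, hl⟩ := exists_iterate_subdiv_mem hf.isOpen_range hB hcover z
  obtain ⟨a, ha, b, hb, hab⟩ := Submodule.mem_sup.1 hl
  obtain ⟨c, rfl⟩ := exists_map_eq_of_mem_chainSpan hf.isEmbedding ha
  obtain ⟨t, ht⟩ := exists_sub_iterate_subdiv_sub_d_mem hj hx l
  have h1 : (subdiv X R n).hom^[l] x -
      (((TopCat.toSSet.obj X).chainComplex R).d (n + 1) n).hom c ∈
        chainSpan R (simplicesIn (f ⁻¹' B) n) := by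
    refine mem_chainSpan_of_map_mem hf.isEmbedding ?_
    rw [map_sub, map_iterate_subdiv, ← d_map, eq_sub_of_add_eq hab, map_sub, d_iterate_subdiv]
    have h4 := iterate_subdiv_mem_chainSpan hz l
    rw [iterate_map_sub] at h4
    convert! add_mem h4 (d_mem_chainSpan n hb) using 1
    abel
  refine ⟨c + t, ?_⟩
  convert! add_mem ht h1 using 1
  rw [map_add]
  abel

/-- Excision: an open embedding `f : X → Y` induces an isomorphism
`H_n(X, f⁻¹ B) ≅ H_n(Y, B)` if `B` is open and `Y = f(X) ∪ B`. -/
theorem isIso_relHomology_map_pairMap {X Y : Type w} [TopologicalSpace X] [TopologicalSpace Y]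
    {f : C(X, Y)} (hf : Topology.IsOpenEmbedding f) {A : Set X} {B : Set Y} (hB : IsOpen B)
    (hA : f ⁻¹' B = A) (hcover : Set.range f ∪ B = Set.univ) (h : Set.MapsTo f A B)
    (R : ModuleCat.{max w v} k) (n : ℕ) :
    IsIso ((relHomology R n).map (pairMap f h)) := by
  subst hA
  have w := congrArg ((singularChainComplexFunctor (ModuleCat.{max w v} k)).obj R).map
    (TopPair.Hom.w (pairMap f h)).symm
  rw [Functor.map_comp, Functor.map_comp] at w
  -- The target degree of the differential is n - 1 for positive n. For n = 0 it is 0, where the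
  -- differential vanishes and every chain is a relative cycle.
  refine isIso_homologyMap_cokernelMap (j := (ComplexShape.down ℕ).next n)
    (SSet.chainComplexMap
      (TopCat.toSSet.map (TopPair.ofSubset (X := TopCat.of X) (f ⁻¹' B)).map) R)
    (SSet.chainComplexMap (TopCat.toSSet.map (TopPair.ofSubset (X := TopCat.of Y) B).map) R)
    (SSet.chainComplexMap (TopCat.toSSet.map (TopPair.Hom.snd (pairMap f h))) R)
    (SSet.chainComplexMap (TopCat.toSSet.map (TopCat.ofHom f)) R) w rfl ?_ ?_
  · intro y
    simp only [range_chainComplexMap_ofSubset]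
    exact exists_relCycle_of_cover (f := TopCat.ofHom f) hf hB hcover rfl
  · intro x
    simp only [range_chainComplexMap_ofSubset]
    rintro hx ⟨z, hz⟩
    exact exists_sub_d_mem_of_cover (f := TopCat.ofHom f) hf hB hcover rfl hx hz

end Excision

/-! ### Naturality of the cap product -/

section CapNaturality

variable {C : Type u} [Category.{v} C] [Abelian C] [HasCoproducts.{w} C] (R : C)

/-- Simplicial maps commute with passage to front and back faces. -/
lemma chainComplexMap_capChain {X X' : SSet.{w}} (f : X ⟶ X') {d n m : ℕ} (h : d + n = m)
    (c : X' _⦋d⦌ → ℤ) :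
    (SSet.chainComplexMap f R).f m ≫ capChain R X' h c =
      capChain R X h (fun s => c (f.app _ s)) ≫ (SSet.chainComplexMap f R).f n := by
  apply SSet.chainComplex_hom_ext
  intro s
  rw [SSet.ι_chainComplexMap_f_assoc, ι_capChain, ι_capChain_assoc, Preadditive.zsmul_comp,
    SSet.ι_chainComplexMap_f, ← NatTrans.naturality_apply f (frontFace h).op s,
    ← NatTrans.naturality_apply f (backFace h).op s]

section

variable {A X A' X' : SSet.{w}} {i : A ⟶ X} {i' : A' ⟶ X'} {f : X ⟶ X'} {g : A ⟶ A'}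
  (h : SSet.chainComplexMap i R ≫ SSet.chainComplexMap f R =
    SSet.chainComplexMap g R ≫ SSet.chainComplexMap i' R)
  {d n m : ℕ} (hm : d + n = m) {c : X' _⦋d⦌ → ℤ}

lemma cokernelMap_relCapChain (hc : c ∈ relCochains i' d)
    (hc' : (fun s => c (f.app _ s)) ∈ relCochains i d) :
    (cokernel.map _ _ _ _ h).f m ≫ relCapChain R i' hm c hc =
      relCapChain R i hm _ hc' ≫ (SSet.chainComplexMap f R).f n := by
  apply cokernel_X_hom_ext
  have h1 : cokernel.π (SSet.chainComplexMap i R) ≫ cokernel.map _ _ _ _ h =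
      SSet.chainComplexMap f R ≫ cokernel.π (SSet.chainComplexMap i' R) := cokernel.π_desc _ _ _
  have h2 := HomologicalComplex.congr_hom h1 m
  rw [HomologicalComplex.comp_f, HomologicalComplex.comp_f] at h2
  rw [reassoc_of% h2, relCapChain, relCapChain, π_cokernelDesc_assoc, π_cokernelDesc,
    chainComplexMap_capChain]

/-- Cycles embed in chains and surject onto homology, so the chain-level identity determines the map
on cycles and then on homology. -/
lemma homologyMap_cokernelMap_capCocycle (hc : c ∈ relCocycles i' d)
    (hc' : (fun s => c (f.app _ s)) ∈ relCocycles i d) :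
    HomologicalComplex.homologyMap (cokernel.map _ _ _ _ h) m ≫ capCocycle R i' hm c hc =
      capCocycle R i hm _ hc' ≫ HomologicalComplex.homologyMap (SSet.chainComplexMap f R) n := by
  have hcyc : HomologicalComplex.cyclesMap (cokernel.map _ _ _ _ h) m ≫ capCycles R i' hm c hc =
      capCycles R i hm _ hc' ≫ HomologicalComplex.cyclesMap (SSet.chainComplexMap f R) n := by
    rw [← cancel_mono (HomologicalComplex.iCycles _ n), Category.assoc, Category.assoc, capCycles_i,
      HomologicalComplex.cyclesMap_i, HomologicalComplex.cyclesMap_i_assoc,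
      cokernelMap_relCapChain R h hm hc.1 hc'.1, ← Category.assoc, ← Category.assoc, capCycles_i]
  rw [← cancel_epi (HomologicalComplex.homologyπ _ m),
    HomologicalComplex.homologyπ_naturality_assoc, π_capCocycle, reassoc_of% hcyc,
    ← HomologicalComplex.homologyπ_naturality, ← Category.assoc, ← Category.assoc, π_capCocycle]

end

variable {P Q : TopPair.{w}} (f : P ⟶ Q)

/-- Naturality of the cap product: `f_*(f^* τ ∩ a) = τ ∩ f_* a`. -/
lemma relHomology_map_cap (d n : ℕ) (τ : relCohomology d Q) :
    (relHomology R (d + n)).map f ≫ cap R d n Q τ =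
      cap R d n P (cohomologyMap d f τ) ≫
        ((singularHomologyFunctor C n).obj R).map (TopPair.Hom.fst f) := by
  obtain ⟨c, rfl⟩ := QuotientAddGroup.mk_surjective τ
  have h := congrArg ((singularChainComplexFunctor C).obj R).map (TopPair.Hom.w f).symm
  rw [Functor.map_comp, Functor.map_comp] at h
  exact homologyMap_cokernelMap_capCocycle R (i := TopCat.toSSet.map P.map)
    (i' := TopCat.toSSet.map Q.map) (f := TopCat.toSSet.map (TopPair.Hom.fst f))
    (g := TopCat.toSSet.map (TopPair.Hom.snd f)) h rfl c.2 (pullCochain_mem_relCocycles f d c.2)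

lemma cohomologyMap_comp {P' : TopPair.{w}} (g : P' ⟶ P) (d : ℕ) (τ : relCohomology d Q) :
    cohomologyMap d (g ≫ f) τ = cohomologyMap d g (cohomologyMap d f τ) := by
  obtain ⟨c, rfl⟩ := QuotientAddGroup.mk_surjective τ
  rfl

end CapNaturality

/-! ### Umkehr maps do not depend on the tubular neighbourhood -/

/-- A continuous map with values in the range of an embedding lifts. -/
lemma exists_continuous_lift {T X Y : Type*} [TopologicalSpace T] [TopologicalSpace X]
    [TopologicalSpace Y] {f : X → Y} (hf : Topology.IsEmbedding f) (g : C(T, Y))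
    (hg : ∀ t, g t ∈ Set.range f) : ∃ g' : C(T, X), ∀ t, f (g' t) = g t := by
  choose g' hg' using hg
  refine ⟨⟨g', ?_⟩, hg'⟩
  rw [hf.continuous_iff]
  exact g.continuous.congr fun t => (hg' t).symm

/-- The tube lemma: the complement is the projection of a closed set along a compact factor. -/
lemma isOpen_setOf_forall_of_compactSpace {T X : Type*} [TopologicalSpace T] [CompactSpace T]
    [TopologicalSpace X] {O : Set (T × X)} (hO : IsOpen O) : IsOpen {x | ∀ t, (t, x) ∈ O} := by
  have h := isClosedMap_snd_of_compactSpace (X := T) (Y := X) _ hO.isClosed_compl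
  rw [← isOpen_compl_iff] at h
  convert! h using 1
  ext x
  simp

namespace TubularNeighbourhood

variable {d : ℕ} {X Y : Type w} [TopologicalSpace X] [TopologicalSpace Y] {e : C(X, Y)}
  (N : TubularNeighbourhood d e)

/-- Multiplication by scalars in the fibres of the normal bundle. -/
def scale (p : ℝ × N.Total) : N.Total := ⟨p.2.1, p.1 • p.2.2⟩

/-- A local trivialization is linear on fibres, so there scaling becomes scalar multiplication in
the model fibre. -/
lemma continuous_scale : Continuous N.scale := by
  rw [continuous_iff_continuousAt]
  rintro ⟨t, v⟩
  rw [FiberBundle.continuousAt_totalSpace]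
  refine ⟨(N.projMap.continuous.comp continuous_snd).continuousAt, ?_⟩
  let T := trivializationAt (EuclideanSpace ℝ (Fin d)) N.normal v.1
  have hv : v.1 ∈ T.baseSet :=
    FiberBundle.mem_baseSet_trivializationAt (EuclideanSpace ℝ (Fin d)) N.normal v.1
  have hT : ContinuousAt (fun p : ℝ × N.Total => p.1 • (T p.2).2) (t, v) := by
    refine continuousAt_fst.smul (continuousAt_snd.comp ?_)
    refine ContinuousAt.comp (f := Prod.snd) (g := T) ?_ continuousAt_snd
    exact T.continuousAt (T.mem_source.2 hv)
  refine hT.congr ?_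
  have hnear : ∀ᶠ p : ℝ × N.Total in nhds (t, v), p.2.1 ∈ T.baseSet :=
    (N.projMap.continuous.comp continuous_snd).continuousAt.eventually_mem
      (T.open_baseSet.mem_nhds hv)
  filter_upwards [hnear] with p hp
  exact ((T.linear ℝ hp).map_smul p.1 p.2.2).symm

lemma scale_one (v : N.Total) : N.scale (1, v) = v := by
  simp [scale]

lemma scale_zero (v : N.Total) : N.scale (0, v) = ⟨v.1, 0⟩ := by
  simp [scale]

lemma scale_zeroSection (t : ℝ) (x : X) : N.scale (t, ⟨x, 0⟩) = ⟨x, 0⟩ := by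
  simp [scale]

/-- The zero section already covers Z, and exp is injective, so no nonzero vector can land in Z. -/
lemma exp_mem_iff {Z : Set Y} (hZ : Set.range e = Z) (v : N.Total) : N.exp v ∈ Z ↔ v.2 = 0 := by
  refine ⟨fun h => by_contra fun hv => N.mapsTo_expMap hZ hv h, fun h => ?_⟩
  obtain ⟨x, v⟩ := v
  obtain rfl : v = 0 := h
  rw [N.exp_zero, ← hZ]
  exact ⟨x, rfl⟩

lemma preimage_compl {Z : Set Y} (hZ : Set.range e = Z) : N.expMap ⁻¹' Zᶜ = N.nonzero := by
  ext v
  exact not_congr (N.exp_mem_iff hZ v)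

lemma isOpen_nonzero {Z : Set Y} (hZ : Set.range e = Z) (hclosed : IsClosed Z) :
    IsOpen N.nonzero := by
  rw [← N.preimage_compl hZ]
  exact hclosed.isOpen_compl.preimage N.expMap.continuous

lemma isIso_excision {k : Type v} [Ring k] (R : ModuleCat.{max w v} k) {Z : Set Y}
    (hZ : Set.range e = Z) (hclosed : IsClosed Z) (n : ℕ) : IsIso (N.excision R hZ n) := by
  refine isIso_relHomology_map_pairMap N.isOpenEmbedding_exp hclosed.isOpen_compl
    (N.preimage_compl hZ) (Set.eq_univ_of_forall fun y => ?_) _ R n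
  by_cases hy : y ∈ Z
  · rw [← hZ] at hy
    obtain ⟨x, rfl⟩ := hy
    exact Or.inl ⟨⟨x, 0⟩, N.exp_zero x⟩
  · exact Or.inr hy

end TubularNeighbourhood

/-- Two routes to `B` are compared through a common refinement `W`: as `p`, `e` and `e'` are
invertible, so is `p'`, and e⁻¹ can be rewritten as the inverse of `e'`, then that of `p'`, then
`p`. -/
lemma comp_inverseOf_comp {C : Type u} [Category.{v} C] [Preadditive C] {A B P P' W H H' K L : C}
    (a : A ⟶ B) {e : P ⟶ B} {e' : P' ⟶ B} (he : IsIso e) (he' : IsIso e') {p : W ⟶ P} {p' : W ⟶ P'}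
    (hp : IsIso p) (hcomm : p ≫ e = p' ≫ e') {c : P ⟶ H} {c' : P' ⟶ H'} {q : H ⟶ K} {q' : H' ⟶ L}
    {g : K ⟶ L} (h : p ≫ c ≫ q ≫ g = p' ≫ c' ≫ q') :
    (a ≫ inverseOf e ≫ c ≫ q) ≫ g = a ≫ inverseOf e' ≫ c' ≫ q' := by
  have hi : inverseOf e = inv e := dif_pos he
  have hi' : inverseOf e' = inv e' := dif_pos he'
  have hp' : IsIso p' := by
    have : IsIso (p' ≫ e') := hcomm ▸ inferInstance
    exact IsIso.of_isIso_comp_right p' e'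
  have hinv : inv e = inv e' ≫ inv p' ≫ p := by
    rw [IsIso.inv_eq_of_hom_inv_id]
    rw [← cancel_epi p, reassoc_of% hcomm]
    simp
  simp only [hi, hi', hinv, Category.assoc, h, IsIso.inv_hom_id_assoc]

lemma pairMap_comp_eq {T X X' Y : Type w} [TopologicalSpace T] [TopologicalSpace X]
    [TopologicalSpace X'] [TopologicalSpace Y] {A : Set T} {B : Set X} {B' : Set X'} {D : Set Y}
    {p : C(T, X)} {p' : C(T, X')} {f : C(X, Y)} {f' : C(X', Y)} (hp : Set.MapsTo p A B)
    (hp' : Set.MapsTo p' A B') (hf : Set.MapsTo f B D) (hf' : Set.MapsTo f' B' D)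
    (h : ∀ t, f (p t) = f' (p' t)) :
    pairMap p hp ≫ pairMap f hf = pairMap p' hp' ≫ pairMap f' hf' := by
  have h1 : f.comp p = f'.comp p' := ContinuousMap.ext h
  have key : ∀ {g g' : C(T, Y)} (hg : Set.MapsTo g A D) (hg' : Set.MapsTo g' A D), g = g' →
      pairMap g hg = pairMap g' hg' := by
    rintro g _ hg hg' rfl
    rfl
  exact key (hf.comp hp) (hf'.comp hp') h1

section Independence

variable {d : ℕ} {X X' Y : Type w} [TopologicalSpace X] [TopologicalSpace X'] [TopologicalSpace Y]
  {e : C(X, Y)} {e' : C(X', Y)}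

/-- The umkehr maps of two embeddings with the same closed image, with arbitrary tubular
neighbourhoods, agree. -/
theorem umkehr_comp_map {k : Type v} [Ring k] (R : ModuleCat.{max w v} k)
    (N : TubularNeighbourhood d e) (N' : TubularNeighbourhood d e') {Z : Set Y}
    (hZ : Set.range e = Z) (hZ' : Set.range e' = Z) (hclosed : IsClosed Z) (g : C(X, X'))
    (hg : ∀ x, e' (g x) = e x)
    (τ : relCohomology d (TopPair.ofSubset (X := TopCat.of Y) Zᶜ)) (n : ℕ) :
    umkehr R N hZ τ n ≫
      ((singularHomologyFunctor (ModuleCat.{max w v} k) n).obj R).map (TopCat.ofHom g) =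
        umkehr R N' hZ' τ n := by
  -- The condition is on the whole segment from the zero section to v, not just on its end point:
  -- the homotopy between the projections runs along these segments.
  let W : Set N.Total := {v | ∀ t : I, N.exp (N.scale (t, v)) ∈ Set.range N'.exp}
  have hW : IsOpen W := isOpen_setOf_forall_of_compactSpace
    (O := (fun p : I × N.Total => N.exp (N.scale (p.1, p.2))) ⁻¹' Set.range N'.exp)
    (N'.isOpenEmbedding_exp.isOpen_range.preimage (N.isOpenEmbedding_exp.continuous.comp
      (N.continuous_scale.comp ((continuous_subtype_val.comp continuous_fst).prodMk
        continuous_snd))))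
  have hzero : ∀ x, (⟨x, 0⟩ : N.Total) ∈ W := fun x t => by
    rw [N.scale_zeroSection, N.exp_zero, ← hg, ← N'.exp_zero]
    exact ⟨_, rfl⟩
  let G₀ : C(I × W, Y) := ⟨fun p => N.exp (N.scale (p.1, p.2.1)),
    N.isOpenEmbedding_exp.continuous.comp (N.continuous_scale.comp
      ((continuous_subtype_val.comp continuous_fst).prodMk
        (continuous_subtype_val.comp continuous_snd)))⟩
  -- G(t, v) = exp'⁻¹(exp(tv)). Its end at t = 1 is the second embedding `p'`, and its projection to
  -- X' is the homotopy.
  obtain ⟨G, hG⟩ := exists_continuous_lift N'.isOpenEmbedding_exp.isEmbedding G₀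
    fun p => p.2.2 p.1
  let p : C(W, N.Total) := ⟨Subtype.val, continuous_subtype_val⟩
  let p' : C(W, N'.Total) := G.comp ((ContinuousMap.const W 1).prodMk (ContinuousMap.id W))
  have hpp' : ∀ a : W, N.exp (p a) = N'.exp (p' a) := fun a => by
    refine Eq.trans ?_ (hG (1, a)).symm
    exact congrArg N.exp (N.scale_one a.1).symm
  have hp : Topology.IsOpenEmbedding p := hW.isOpenEmbedding_subtypeVal
  have hp' : Topology.IsOpenEmbedding p' := by
    refine Topology.IsOpenEmbedding.of_comp _ N'.isOpenEmbedding_exp ?_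
    have : N'.exp ∘ p' = N.exp ∘ p := funext fun a => (hpp' a).symm
    rw [this]
    exact N.isOpenEmbedding_exp.comp hp
  -- In both bundles the nonzero vectors are the preimage of the complement of Z, so p and p'
  -- determine the same pair (W, W ∖ 0).
  have hA : p' ⁻¹' N'.nonzero = p ⁻¹' N.nonzero := by
    rw [← N.preimage_compl hZ, ← N'.preimage_compl hZ']
    ext a
    change N'.exp (p' a) ∉ Z ↔ N.exp (p a) ∉ Z
    rw [hpp']
  have hmp : Set.MapsTo p (p ⁻¹' N.nonzero) N.nonzero := Set.mapsTo_preimage _ _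
  have hmp' : Set.MapsTo p' (p ⁻¹' N.nonzero) N'.nonzero := by
    rw [← hA]
    exact Set.mapsTo_preimage _ _
  -- Excision in ν: W and the nonzero vectors form an open cover, because W contains the zero
  -- section.
  have hiso : IsIso ((relHomology R (d + n)).map (pairMap p hmp)) := by
    refine isIso_relHomology_map_pairMap hp (N.isOpen_nonzero hZ hclosed) rfl
      (Set.eq_univ_of_forall fun v => ?_) hmp R _
    by_cases hv : v.2 = 0
    · obtain ⟨x, v⟩ := v
      obtain rfl : v = 0 := hv
      exact Or.inl ⟨⟨_, hzero x⟩, rfl⟩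
    · exact Or.inr hv
  have hcomm : pairMap p hmp ≫ N.expPair hZ = pairMap p' hmp' ≫ N'.expPair hZ' :=
    pairMap_comp_eq _ _ _ _ hpp'
  have hexc : IsIso (N.excision R hZ (d + n)) := N.isIso_excision R hZ hclosed _
  have hexc' : IsIso (N'.excision R hZ' (d + n)) := N'.isIso_excision R hZ' hclosed _
  have hcomm' : (relHomology R (d + n)).map (pairMap p hmp) ≫ N.excision R hZ (d + n) =
      (relHomology R (d + n)).map (pairMap p' hmp') ≫ N'.excision R hZ' (d + n) := by
    have h := congrArg (relHomology R (d + n)).map hcomm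
    rwa [Functor.map_comp, Functor.map_comp] at h
  have hhom : ((singularHomologyFunctor (ModuleCat.{max w v} k) n).obj R).map (TopCat.ofHom p) ≫
      ((singularHomologyFunctor (ModuleCat.{max w v} k) n).obj R).map (TopCat.ofHom N.projMap) ≫
      ((singularHomologyFunctor (ModuleCat.{max w v} k) n).obj R).map (TopCat.ofHom g) =
    ((singularHomologyFunctor (ModuleCat.{max w v} k) n).obj R).map (TopCat.ofHom p') ≫
      ((singularHomologyFunctor (ModuleCat.{max w v} k) n).obj R).map
        (TopCat.ofHom N'.projMap) := by
    rw [← Functor.map_comp, ← Functor.map_comp, ← Functor.map_comp]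
    let H : TopCat.Homotopy (TopCat.ofHom p ≫ TopCat.ofHom N.projMap ≫ TopCat.ofHom g)
        (TopCat.ofHom p' ≫ TopCat.ofHom N'.projMap) :=
      { toContinuousMap := N'.projMap.comp G
        map_zero_left := fun a => by
          -- At t = 0 the segment is at e(x) = e'(g(x)), so the lift is the zero vector at g(x).
          have h0 : G (0, a) = ⟨g a.1.1, 0⟩ := by
            apply N'.isOpenEmbedding_exp.injective
            rw [hG, N'.exp_zero, hg, ← N.exp_zero]
            exact congrArg N.exp (N.scale_zero a.1)
          exact congrArg N'.projMap h0
        map_one_left := fun a => rfl }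
    exact H.congr_homologyMap_singularChainComplexFunctor R n
  have key : (relHomology R (d + n)).map (pairMap p hmp) ≫
      cap R d n _ (cohomologyMap d (N.expPair hZ) τ) ≫
      ((singularHomologyFunctor (ModuleCat.{max w v} k) n).obj R).map (TopCat.ofHom N.projMap) ≫
      ((singularHomologyFunctor (ModuleCat.{max w v} k) n).obj R).map (TopCat.ofHom g) =
    (relHomology R (d + n)).map (pairMap p' hmp') ≫
      cap R d n _ (cohomologyMap d (N'.expPair hZ') τ) ≫
      ((singularHomologyFunctor (ModuleCat.{max w v} k) n).obj R).map
        (TopCat.ofHom N'.projMap) := by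
    -- Both sides become cap products on (W, W ∖ 0). The two pull-backs of τ agree because the two
    -- maps of pairs to (Y, Y ∖ Z) do, which leaves only the homotopic projections.
    rw [← Category.assoc, relHomology_map_cap, ← Category.assoc ((relHomology R (d + n)).map _),
      relHomology_map_cap, ← cohomologyMap_comp, ← cohomologyMap_comp, hcomm, Category.assoc,
      Category.assoc]
    exact congrArg (fun f => cap R d n _ _ ≫ f) hhom
  exact comp_inverseOf_comp _ hexc hexc' hiso hcomm' key

end Independence

/-! ### The umkehr map of the composition of loops -/

section Loops

variable (d : ℕ) (M : Type w) [TopologicalSpace M] [ChartedSpace (EuclideanSpace ℝ (Fin d)) M]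

/-- The equalizer of two evaluations into a Hausdorff space; closedness is what excision requires of
the image. -/
lemma isClosed_halfSet [T2Space M] : IsClosed (halfSet d M) :=
  isClosed_eq (LoopSpace.ev half).continuous (LoopSpace.ev 0).continuous

variable {d M}

/-- The umkehr map of `δ_in` is `comp_!`. -/
theorem deltaInUmkehr_eq_compUmkehr [T2Space M] (k : Type v) [Ring k]
    (τ : relCohomology d (diagonalPair M)) (N : TubularNeighbourhood d (deltaIn d M))
    (N' : TubularNeighbourhood d (inclHalf d M)) (n : ℕ) :
    deltaInUmkehr k τ N n = compUmkehr k τ N' n :=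
  -- Since j̃ ∘ γ = δ_in holds definitionally, γ_* ∘ (δ_in)_! = j̃_!; it remains to move γ_* to the
  -- other side.
  (Iso.eq_comp_inv (pushforwardIso k n (concatHomeo d M))).2
    (umkehr_comp_map (coeff.{w} k) N N' (range_deltaIn d M) (range_inclHalf d M)
      (isClosed_halfSet d M) ⟨concatHomeo d M, (concatHomeo d M).continuous⟩ (fun _ => rfl)
      (loopThomClass τ) n)

end Loops

end StringTopology
end

theorem theorem1 {d : ℕ} {M : Type w} [TopologicalSpace M] [T2Space M] [CompactSpace M]
    [ChartedSpace (EuclideanSpace ℝ (Fin d)) M] [IsManifold (𝓡 d) ∞ M]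
    (k : Type v) [Ring k]
    (o : StringTopology.HomologyOrientation d M)
    (τ : StringTopology.relCohomology d (StringTopology.diagonalPair M))
    (hτ : StringTopology.IsThomClass o τ)
    (N : StringTopology.TubularNeighbourhood d (StringTopology.deltaIn d M))
    (N' : StringTopology.TubularNeighbourhood d (StringTopology.inclHalf d M)) (n : ℕ) :
    (IsIso (N.excision (StringTopology.coeff.{w} k) (StringTopology.range_deltaIn d M) (d + n)) ∧
      IsIso (N'.excision (StringTopology.coeff.{w} k) (StringTopology.range_inclHalf d M) (d + n))) ∧
    StringTopology.deltaInUmkehr k τ N n = StringTopology.compUmkehr k τ N' n ∧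
    StringTopology.loopCoproduct k τ N n =
      StringTopology.compUmkehr k τ N' n ≫
        StringTopology.pushforward k n (StringTopology.inclComposable d M) := by
  refine ⟨⟨N.isIso_excision _ _ (StringTopology.isClosed_halfSet d M) _,
    N'.isIso_excision _ _ (StringTopology.isClosed_halfSet d M) _⟩, ?_, ?_⟩
  · exact StringTopology.deltaInUmkehr_eq_compUmkehr k τ N N' n
  · rw [← StringTopology.deltaInUmkehr_eq_compUmkehr k τ N N' n]
    -- The maps `deltaOut` and `inclComposable` agree definitionally.
    rfl
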